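/- Let $\mathbf{C}$ be an adhesive category: it has pullbacks, it has pushouts along monomorphisms, and pushouts along monomorphisms are van Kampen squares. For $a\colon A\to B$ and $c\colon B\to X$, a *final pullback complement* (FPC) of $(c,a)$ is a pair $(d\colon D\to X,\ b\colon A\to D)$ such that $(a,b)$ is a pullback of $(c,d)$ and such that, whenever $(x\colon P\to B,\ y\colon P\to Z)$ is a pullback of $(c,\ z\colon Z\to X)$ and $w\colon P\to A$ satisfies $a\circ w=x$, there is a unique $w^*\colon Z\to D$ with $d\circ w^*=z$ and $w^*\circ y=b\circ w$. Assume that an FPC of $(c,a)$ exists whenever $a,c$ are monomorphisms, and that then $b,d$ are monomorphisms. Assume moreover that $\mathbf{C}$ has a strict initial object $\varnothing$ (every morphism $X\to\varnothing$ is an isomorphism), that $\mathbf{C}$ is finitary (every object has only finitely many subobjects), and that for all objects $Y,X$ there are only finitely many monomorphisms $Y\to X$. A *linear rule* is a span of monomorphisms $p=(O\xleftarrow{o}K\xrightarrow{i}I)$. Two linear rules are isomorphic if there are isomorphisms of their $O$, $K$ and $I$ commuting with the legs. Let $\mathrm{Lin}(\mathbf{C})$ be the collection of isomorphism classes of linear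 rules. An *admissible match* of $p_2$ into $p_1$ is a span of monomorphisms $\mathbf{m}=(I_2\xleftarrow{m_2}M\xrightarrow{m_1}O_1)$ such that, for the pushout $I_2\xrightarrow{n_2}N\xleftarrow{n_1}O_1$ of $\mathbf m$, the pair $K_1\xrightarrow{o_1}O_1\xrightarrow{n_1}N$ has a pushout complement $K_1\xrightarrow{k_1}\overline K_1\xrightarrow{o_1'}N$. Matches are identified when they are isomorphic as spans between $I_2$ and $O_1$. The *composite* $p_2\circ_{\mathbf m}p_1$ is the (class of the) rule $O_{21}\leftarrow K_{21}\to I_{21}$ obtained as follows: - $I_{21}$ is the pushout of $I_1\xleftarrow{i_1}K_1\xrightarrow{k_1}\overline K_1$; - $(i_2'\colon\overline K_2\to N,\ k_2\colon K_2\to \overline K_2)$ is the FPC of $(n_2,i_2)$; - $O_{21}$ is the pushout of $O_2\xleftarrow{o_2}K_2\xrightarrow{k_2}\overline K_2$; - $K_{21}$ is the pullback of $\overline K_2\xrightarrow{i_2'} N\xleftarrow{o_1'}\overline K_1$; - the legs are $K_{21}\to\overline K_2\to O_{21}$ and $K_{21}\to\overline K_1\to I_{21}$. Let $\mathcal R_{\mathbf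 C}$ be the free real vector space with basis $\{\delta(p)\mid p\in \mathrm{Lin}(\mathbf C)\}$, with the bilinear product $\odot$ determined by $$\delta(p_2)\odot\delta(p_1)=\sum_{\mathbf m}\delta(p_2\circ_{\mathbf m}p_1),$$ where $\mathbf m$ runs over all admissible matches of $p_2$ into $p_1$. **Theorem.** For all linear rules $p_2,p_1$ the set of admissible matches of $p_2$ into $p_1$ is finite, and $(\mathcal R_{\mathbf C},\odot)$ is an associative unital $\mathbb R$-algebra with unit element $\delta(\varnothing\leftarrow\varnothing\to\varnothing)$. -/

import Mathlib

open CategoryTheory CategoryTheory.Limits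

universe v u

namespace SqPO

variable {C : Type u} [Category.{v} C]

/-! ### Final pullback complements -/

/-- For `a : A ⟶ B` and `c : B ⟶ X`, the pair `(d, b)` with `b : A ⟶ D`, `d : D ⟶ X` is a
final pullback complement of `(c, a)`. -/
structure IsFPC {A B D X : C} (a : A ⟶ B) (c : B ⟶ X) (b : A ⟶ D) (d : D ⟶ X) : Prop where
  isPullback : IsPullback a b c d
  existsUnique_lift : ∀ {P Z : C} (x : P ⟶ B) (y : P ⟶ Z) (z : Z ⟶ X) (w : P ⟶ A),
    IsPullback x y c z → w ≫ a = x → ∃! t : Z ⟶ D, t ≫ d = z ∧ y ≫ t = w ≫ b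

variable (C) in
/-- All final pullback complements along (composable pairs of) monomorphisms exist, and
monomorphisms are stable under final pullback complements. -/
class HasMonoFPCs : Prop where
  exists_isFPC : ∀ {A B X : C} (a : A ⟶ B) (c : B ⟶ X) [Mono a] [Mono c],
    ∃ (D : C) (b : A ⟶ D) (d : D ⟶ X), IsFPC a c b d
  mono_of_isFPC : ∀ {A B D X : C} {a : A ⟶ B} {c : B ⟶ X} {b : A ⟶ D} {d : D ⟶ X}
    [Mono a] [Mono c], IsFPC a c b d → Mono b ∧ Mono d

/-! ### Linear rules -/

theorem inv_comm {W X W' X' : C} {f : W ⟶ X} {f' : W' ⟶ X'} {eW : W ≅ W'} {eX : X ≅ X'}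
    (h : f ≫ eX.hom = eW.hom ≫ f') : f' ≫ eX.inv = eW.inv ≫ f := by
  rw [Iso.comp_inv_eq, Category.assoc, h, Iso.inv_hom_id_assoc]

variable (C) in
/-- A linear rule: a span of monomorphisms `O ⟵ K ⟶ I` with output `O` and input `I`. -/
structure Rule where
  O : C
  K : C
  I : C
  o : K ⟶ O
  i : K ⟶ I
  [mono_o : Mono o]
  [mono_i : Mono i]

attribute [instance] Rule.mono_o Rule.mono_i

/-- An isomorphism of linear rules. -/
structure RuleIso (p q : Rule C) where
  eO : p.O ≅ q.O
  eK : p.K ≅ q.K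
  eI : p.I ≅ q.I
  comm_o : p.o ≫ eO.hom = eK.hom ≫ q.o
  comm_i : p.i ≫ eI.hom = eK.hom ≫ q.i

def RuleIso.refl (p : Rule C) : RuleIso p p :=
  ⟨Iso.refl _, Iso.refl _, Iso.refl _, by simp, by simp⟩

def RuleIso.symm {p q : Rule C} (e : RuleIso p q) : RuleIso q p :=
  ⟨e.eO.symm, e.eK.symm, e.eI.symm,
    inv_comm e.comm_o,
    inv_comm e.comm_i⟩

def RuleIso.trans {p q r : Rule C} (e : RuleIso p q) (f : RuleIso q r) : RuleIso p r :=
  ⟨e.eO ≪≫ f.eO, e.eK ≪≫ f.eK, e.eI ≪≫ f.eI,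
    by simp [reassoc_of% e.comm_o, f.comm_o], by simp [reassoc_of% e.comm_i, f.comm_i]⟩

variable (C) in
instance ruleSetoid : Setoid (Rule C) where
  r p q := Nonempty (RuleIso p q)
  iseqv := ⟨fun p => ⟨RuleIso.refl p⟩, fun ⟨e⟩ => ⟨e.symm⟩, fun ⟨e⟩ ⟨f⟩ => ⟨e.trans f⟩⟩

variable (C) in
/-- Isomorphism classes of linear rules. -/
abbrev Lin : Type (max u v) := Quotient (ruleSetoid C)

/-- The rule `∅ ⟵ ∅ ⟶ ∅`. -/
noncomputable def emptyRule (C : Type u) [Category.{v} C] [HasInitial C] : Rule C where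
  O := ⊥_ C
  K := ⊥_ C
  I := ⊥_ C
  o := 𝟙 _
  i := 𝟙 _

/-! ### Admissible matches -/

/-- An admissible match of `p₂` into `p₁`: a span of monomorphisms `I₂ ⟵ M ⟶ O₁` such that, with
`I₂ ⟶ N ⟵ O₁` the pushout of the span, `K₁ ⟶ O₁ ⟶ N` has a pushout complement. -/
structure Match (p₂ p₁ : Rule C) where
  M : C
  m₂ : M ⟶ p₂.I
  m₁ : M ⟶ p₁.O
  [mono_m₂ : Mono m₂]
  [mono_m₁ : Mono m₁]
  admissible : ∃ (N : C) (n₂ : p₂.I ⟶ N) (n₁ : p₁.O ⟶ N)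
    (L : C) (k : p₁.K ⟶ L) (l : L ⟶ N),
    IsPushout m₂ m₁ n₂ n₁ ∧ IsPushout p₁.o k n₁ l

attribute [instance] Match.mono_m₂ Match.mono_m₁

/-- Matches are identified when they are isomorphic as spans between `I₂` and `O₁`. -/
instance matchSetoid (p₂ p₁ : Rule C) : Setoid (Match p₂ p₁) where
  r m m' := ∃ e : m.M ≅ m'.M, e.hom ≫ m'.m₂ = m.m₂ ∧ e.hom ≫ m'.m₁ = m.m₁
  iseqv := ⟨fun m => ⟨Iso.refl _, by simp, by simp⟩,
    fun ⟨e, h₂, h₁⟩ => ⟨e.symm, by simp [← h₂], by simp [← h₁]⟩,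
    fun ⟨e, h₂, h₁⟩ ⟨f, k₂, k₁⟩ => ⟨e ≪≫ f, by simp [k₂, h₂], by simp [k₁, h₁]⟩⟩

/-- The set of admissible matches of `p₂` into `p₁`. -/
abbrev MatchClass (p₂ p₁ : Rule C) : Type (max u v) := Quotient (matchSetoid p₂ p₁)

/-! ### Composition of rules -/

/-- The diagram that computes the composite of `p₂` with `p₁` along a match `m`. -/
structure CompDiagram {p₂ p₁ : Rule C} (m : Match p₂ p₁) where
  (N K₂' K₁' O₂₁ I₂₁ K₂₁ : C)
  n₂ : p₂.I ⟶ N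
  n₁ : p₁.O ⟶ N
  k₂ : p₂.K ⟶ K₂'
  i₂' : K₂' ⟶ N
  n₂s : p₂.O ⟶ O₂₁
  o₂' : K₂' ⟶ O₂₁
  k₁ : p₁.K ⟶ K₁'
  o₁' : K₁' ⟶ N
  n₁s : p₁.I ⟶ I₂₁
  i₁' : K₁' ⟶ I₂₁
  i₂'' : K₂₁ ⟶ K₂'
  o₁'' : K₂₁ ⟶ K₁'
  po : IsPushout m.m₂ m.m₁ n₂ n₁
  poc : IsPushout p₁.o k₁ n₁ o₁'
  poI : IsPushout p₁.i k₁ n₁s i₁'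
  fpc : IsFPC p₂.i n₂ k₂ i₂'
  poO : IsPushout p₂.o k₂ n₂s o₂'
  pb : IsPullback i₂'' o₁'' i₂' o₁'

theorem isPushout_iso {W X Y P W' X' Y' P' : C} {f : W ⟶ X} {g : W ⟶ Y} {h : X ⟶ P} {i : Y ⟶ P}
    {f' : W' ⟶ X'} {g' : W' ⟶ Y'} {h' : X' ⟶ P'} {i' : Y' ⟶ P'}
    (H : IsPushout f g h i) (H' : IsPushout f' g' h' i')
    (eW : W ≅ W') (eX : X ≅ X') (eY : Y ≅ Y')
    (hf : f ≫ eX.hom = eW.hom ≫ f') (hg : g ≫ eY.hom = eW.hom ≫ g') :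
    ∃ eP : P ≅ P', h ≫ eP.hom = eX.hom ≫ h' ∧ i ≫ eP.hom = eY.hom ≫ i' := by
  have H'' : IsPushout f g (eX.hom ≫ h') (eY.hom ≫ i') :=
    H'.of_iso eW.symm eX.symm eY.symm (Iso.refl _)
      (inv_comm hf) (inv_comm hg)
      (by simp) (by simp)
  exact ⟨H.isoIsPushout _ _ H'', by simp, by simp⟩

theorem isPullback_iso {P X Y Z P' X' Y' Z' : C} {f : P ⟶ X} {g : P ⟶ Y} {h : X ⟶ Z} {i : Y ⟶ Z}
    {f' : P' ⟶ X'} {g' : P' ⟶ Y'} {h' : X' ⟶ Z'} {i' : Y' ⟶ Z'}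
    (H : IsPullback f g h i) (H' : IsPullback f' g' h' i')
    (eX : X ≅ X') (eY : Y ≅ Y') (eZ : Z ≅ Z')
    (hh : h ≫ eZ.hom = eX.hom ≫ h') (hi : i ≫ eZ.hom = eY.hom ≫ i') :
    ∃ eP : P ≅ P', f ≫ eX.hom = eP.hom ≫ f' ∧ g ≫ eY.hom = eP.hom ≫ g' := by
  have H'' : IsPullback (f ≫ eX.hom) (g ≫ eY.hom) h' i' :=
    H.of_iso (Iso.refl _) eX eY eZ (by simp) (by simp) hh hi
  exact ⟨H''.isoIsPullback _ _ H', by simp, by simp⟩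

theorem IsFPC.exists_hom {A B D X A' B' D' X' : C}
    {a : A ⟶ B} {c : B ⟶ X} {b : A ⟶ D} {d : D ⟶ X}
    {a' : A' ⟶ B'} {c' : B' ⟶ X'} {b' : A' ⟶ D'} {d' : D' ⟶ X'}
    (H : IsPullback a b c d) (H' : IsFPC a' c' b' d')
    (eA : A ≅ A') (eB : B ≅ B') (eX : X ≅ X')
    (ha : a ≫ eB.hom = eA.hom ≫ a') (hc : c ≫ eX.hom = eB.hom ≫ c') :
    ∃ t : D ⟶ D', t ≫ d' = d ≫ eX.hom ∧ b ≫ t = eA.hom ≫ b' := by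
  have H'' : IsPullback (a ≫ eB.hom) b c' (d ≫ eX.hom) :=
    H.of_iso (Iso.refl _) eB (Iso.refl _) eX (by simp) (by simp) hc (by simp)
  exact (H'.existsUnique_lift _ _ _ eA.hom H'' ha.symm).exists

theorem IsFPC.iso {A B D X A' B' D' X' : C}
    {a : A ⟶ B} {c : B ⟶ X} {b : A ⟶ D} {d : D ⟶ X}
    {a' : A' ⟶ B'} {c' : B' ⟶ X'} {b' : A' ⟶ D'} {d' : D' ⟶ X'}
    (H : IsFPC a c b d) (H' : IsFPC a' c' b' d') [Mono d] [Mono d']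
    (eA : A ≅ A') (eB : B ≅ B') (eX : X ≅ X')
    (ha : a ≫ eB.hom = eA.hom ≫ a') (hc : c ≫ eX.hom = eB.hom ≫ c') :
    ∃ eD : D ≅ D', b ≫ eD.hom = eA.hom ≫ b' ∧ d ≫ eX.hom = eD.hom ≫ d' := by
  obtain ⟨t, ht, ht'⟩ := IsFPC.exists_hom H.isPullback H' eA eB eX ha hc
  obtain ⟨s, hs, -⟩ := IsFPC.exists_hom H'.isPullback H eA.symm eB.symm eX.symm
    (inv_comm ha)
    (inv_comm hc)
  refine ⟨⟨t, s, ?_, ?_⟩, ht', ht.symm⟩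
  · rw [← cancel_mono d, Category.assoc, hs, reassoc_of% ht]; simp
  · rw [← cancel_mono d', Category.assoc, ht, reassoc_of% hs]; simp

section

variable [Adhesive C]

/-- In an adhesive category, pushouts along monomorphisms are final pullback complements. -/
theorem IsFPC.of_isPushout {A B D X : C} {a : A ⟶ B} {c : B ⟶ X} {b : A ⟶ D} {d : D ⟶ X}
    [Mono a] [Mono c] (h : IsPushout a b c d) : IsFPC a c b d := by
  have : Mono d := Adhesive.mono_of_isPushout_of_mono_left h
  refine ⟨Adhesive.isPullback_of_isPushout_of_mono_left h, ?_⟩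
  intro P Z x y z w hp hw
  have hd : IsPullback (pullback.fst d z) (pullback.snd d z) d z := IsPullback.of_hasPullback d z
  have hx : HasPullback x a := hasPullback_symmetry a x
  obtain ⟨W, f', g', α, hf, -, hpo⟩ :=
    (Adhesive.van_kampen h).exists_cube_filling hp.flip hd.flip
  have : Mono f' := ⟨fun s t hst => by
    refine hf.hom_ext hst ?_
    rw [← cancel_mono a, Category.assoc, Category.assoc, ← hf.w, reassoc_of% hst]⟩
  have hs : hf.lift (𝟙 P) w (by simp [hw]) ≫ f' = 𝟙 P := hf.lift_fst _ _ _
  have : IsSplitEpi f' := ⟨⟨⟨_, hs⟩⟩⟩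
  have : IsIso f' := isIso_of_mono_of_isSplitEpi f'
  have : IsIso (pullback.snd d z) := hpo.isIso_inr_of_isIso
  have hz : (inv (pullback.snd d z) ≫ pullback.fst d z) ≫ d = z := by
    simp [pullback.condition]
  refine ⟨inv (pullback.snd d z) ≫ pullback.fst d z, ⟨hz, ?_⟩, ?_⟩
  · rw [← cancel_mono d, Category.assoc, hz, Category.assoc, ← h.w, reassoc_of% hw, hp.w]
  · rintro t ⟨ht, -⟩
    rw [← cancel_mono d, hz, ht]

variable [HasMonoFPCs C]

theorem Match.nonempty_compDiagram {p₂ p₁ : Rule C} (m : Match p₂ p₁) :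
    Nonempty (CompDiagram m) := by
  obtain ⟨N, n₂, n₁, K₁', k₁, o₁', po, poc⟩ := m.admissible
  have : Mono n₁ := Adhesive.mono_of_isPushout_of_mono_left po
  have : Mono n₂ := Adhesive.mono_of_isPushout_of_mono_right po
  have : Mono o₁' := Adhesive.mono_of_isPushout_of_mono_left poc
  obtain ⟨K₂', k₂, i₂', fpc⟩ := HasMonoFPCs.exists_isFPC p₂.i n₂
  have : HasPullback i₂' o₁' := hasPullback_symmetry o₁' i₂'
  exact ⟨⟨_, _, _, _, _, _, _, _, _, _, _, _, _, _, _, _, _, _, po, poc,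
    IsPushout.of_hasPushout p₁.i k₁, fpc, IsPushout.of_hasPushout p₂.o k₂,
    IsPullback.of_hasPullback i₂' o₁'⟩⟩

namespace CompDiagram

variable {p₂ p₁ : Rule C} {m : Match p₂ p₁} (D : CompDiagram m)

instance mono_n₁ : Mono D.n₁ := Adhesive.mono_of_isPushout_of_mono_left D.po

instance mono_n₂ : Mono D.n₂ := Adhesive.mono_of_isPushout_of_mono_right D.po

instance mono_o₁' : Mono D.o₁' := Adhesive.mono_of_isPushout_of_mono_left D.poc

instance mono_i₂' : Mono D.i₂' := (HasMonoFPCs.mono_of_isFPC D.fpc).2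

instance mono_o₂' : Mono D.o₂' := Adhesive.mono_of_isPushout_of_mono_left D.poO

instance mono_i₁' : Mono D.i₁' := Adhesive.mono_of_isPushout_of_mono_left D.poI

instance mono_i₂'' : Mono D.i₂'' := ⟨fun _ _ h => D.pb.hom_ext h (by
  rw [← cancel_mono D.o₁', Category.assoc, Category.assoc, ← D.pb.w, reassoc_of% h])⟩

instance mono_o₁'' : Mono D.o₁'' := ⟨fun _ _ h => D.pb.hom_ext (by
  rw [← cancel_mono D.i₂', Category.assoc, Category.assoc, D.pb.w, reassoc_of% h]) h⟩

/-- The composite rule `O₂₁ ⟵ K₂₁ ⟶ I₂₁`. -/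
def comp : Rule C where
  O := D.O₂₁
  K := D.K₂₁
  I := D.I₂₁
  o := D.i₂'' ≫ D.o₂'
  i := D.o₁'' ≫ D.i₁'

theorem nonempty_ruleIso {q₂ q₁ : Rule C} {m' : Match q₂ q₁} (D' : CompDiagram m')
    (f₂ : RuleIso p₂ q₂) (f₁ : RuleIso p₁ q₁) (e : m.M ≅ m'.M)
    (h₂ : m.m₂ ≫ f₂.eI.hom = e.hom ≫ m'.m₂) (h₁ : m.m₁ ≫ f₁.eO.hom = e.hom ≫ m'.m₁) :
    Nonempty (RuleIso D.comp D'.comp) := by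
  obtain ⟨eN, hn₂, hn₁⟩ := isPushout_iso D.po D'.po e f₂.eI f₁.eO h₂ h₁
  obtain ⟨eK₂, hk₂, hi₂⟩ := D.fpc.iso D'.fpc f₂.eK f₂.eI eN f₂.comm_i hn₂
  obtain ⟨eK₁, hk₁, ho₁⟩ := (IsFPC.of_isPushout D.poc).iso (IsFPC.of_isPushout D'.poc)
    f₁.eK f₁.eO eN f₁.comm_o hn₁
  obtain ⟨eO, -, hO⟩ := isPushout_iso D.poO D'.poO f₂.eK f₂.eO eK₂ f₂.comm_o hk₂
  obtain ⟨eI, -, hI⟩ := isPushout_iso D.poI D'.poI f₁.eK f₁.eI eK₁ f₁.comm_i hk₁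
  obtain ⟨eK, hK₂, hK₁⟩ := isPullback_iso D.pb D'.pb eK₂ eK₁ eN hi₂ ho₁
  exact ⟨⟨eO, eK, eI, by simp [comp, hO, reassoc_of% hK₂], by simp [comp, hI, reassoc_of% hK₁]⟩⟩

end CompDiagram

/-- The isomorphism class of the composite of `p₂` with `p₁` along a match. -/
noncomputable def compClass {p₂ p₁ : Rule C} : MatchClass p₂ p₁ → Lin C :=
  Quotient.lift (fun m => ⟦m.nonempty_compDiagram.some.comp⟧) fun _ _ ⟨e, h₂, h₁⟩ =>
    Quotient.sound (CompDiagram.nonempty_ruleIso _ _ (RuleIso.refl _) (RuleIso.refl _) e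
      (by simp [RuleIso.refl, h₂]) (by simp [RuleIso.refl, h₁]))

end

/-! ### Dependence of matches on the rules -/

/-- The transport of a match along isomorphisms of rules. -/
def Match.transport {p₂ p₁ q₂ q₁ : Rule C} (f₂ : RuleIso p₂ q₂) (f₁ : RuleIso p₁ q₁)
    (m : Match p₂ p₁) : Match q₂ q₁ where
  M := m.M
  m₂ := m.m₂ ≫ f₂.eI.hom
  m₁ := m.m₁ ≫ f₁.eO.hom
  admissible := by
    obtain ⟨N, n₂, n₁, L, k, l, h, h'⟩ := m.admissible
    refine ⟨N, f₂.eI.inv ≫ n₂, f₁.eO.inv ≫ n₁, L, f₁.eK.inv ≫ k, l, ?_, ?_⟩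
    · exact h.of_iso (Iso.refl _) f₂.eI f₁.eO (Iso.refl _) (by simp) (by simp) (by simp) (by simp)
    · exact h'.of_iso f₁.eK f₁.eO (Iso.refl _) (Iso.refl _) f₁.comm_o (by simp) (by simp) (by simp)

/-- Isomorphic rules have the same isomorphism classes of matches. -/
def matchEquiv {p₂ p₁ q₂ q₁ : Rule C} (f₂ : RuleIso p₂ q₂) (f₁ : RuleIso p₁ q₁) :
    MatchClass p₂ p₁ ≃ MatchClass q₂ q₁ where
  toFun := Quotient.map (Match.transport f₂ f₁) fun _ _ ⟨e, h₂, h₁⟩ =>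
    ⟨e, by simp [Match.transport, reassoc_of% h₂], by simp [Match.transport, reassoc_of% h₁]⟩
  invFun := Quotient.map (Match.transport f₂.symm f₁.symm) fun _ _ ⟨e, h₂, h₁⟩ =>
    ⟨e, by simp [Match.transport, reassoc_of% h₂], by simp [Match.transport, reassoc_of% h₁]⟩
  left_inv := by
    rintro ⟨m⟩
    exact Quotient.sound ⟨Iso.refl _, by simp [Match.transport, RuleIso.symm],
      by simp [Match.transport, RuleIso.symm]⟩
  right_inv := by
    rintro ⟨m⟩
    exact Quotient.sound ⟨Iso.refl _, by simp [Match.transport, RuleIso.symm],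
      by simp [Match.transport, RuleIso.symm]⟩

/-! ### The rule algebra -/

variable (C) in
/-- The free real vector space on isomorphism classes of linear rules. -/
abbrev RuleAlgebra : Type (max u v) := Lin C →₀ ℝ

/-- The basis vector of the rule algebra given by an isomorphism class of linear rules. -/
noncomputable def δ (p : Lin C) : RuleAlgebra C := Finsupp.single p 1

variable [Adhesive C] [HasMonoFPCs C]

theorem compClass_matchEquiv {p₂ p₁ q₂ q₁ : Rule C} (f₂ : RuleIso p₂ q₂) (f₁ : RuleIso p₁ q₁)
    (m : MatchClass p₂ p₁) : compClass (matchEquiv f₂ f₁ m) = compClass m := by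
  obtain ⟨m⟩ := m
  exact (Quotient.sound (CompDiagram.nonempty_ruleIso _ _ f₂ f₁ (Iso.refl _)
    (by simp [Match.transport]) (by simp [Match.transport]))).symm

/-- The product of two basis vectors: the sum over all isomorphism classes of admissible
matches of the composite along the match. -/
noncomputable def basisMul : Lin C → Lin C → RuleAlgebra C :=
  Quotient.lift₂ (fun p₂ p₁ => ∑ᶠ m : MatchClass p₂ p₁, δ (compClass m))
    fun _ _ _ _ ⟨f₂⟩ ⟨f₁⟩ => finsum_eq_of_bijective (matchEquiv f₂ f₁) (matchEquiv f₂ f₁).bijective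
      fun m => by rw [compClass_matchEquiv]

variable (C) in
/-- The product of the rule algebra: the bilinear extension of the product of basis vectors. -/
noncomputable def mul : RuleAlgebra C →ₗ[ℝ] RuleAlgebra C →ₗ[ℝ] RuleAlgebra C :=
  Finsupp.linearCombination ℝ fun p₂ => Finsupp.linearCombination ℝ fun p₁ => basisMul p₂ p₁

end SqPO

/-! Associativity on basis vectors is a bijection between two kinds of nested pairs of matches. Both
kinds are classified by isomorphism classes of a common object, a `Triple`: X₁ contains I₂ and O₁,
X₂ contains O₂ and I₃, and p₂ rewrites X₁ to X₂ with context L. Intersecting images in a triple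
gives I₂ ∩ O₁ and then I₃ ∩ O₂₁ for the left pairs, I₃ ∩ O₂ and then I₂₁ ∩ O₁ for the right pairs.
Conversely every pair rebuilds its triple up to isomorphism, and the covering conditions make the
triple no larger than the pair. In both cases the composite is `Triple.comp`, so
`exists_bijective_pairs` matches the two sums term by term, and trilinearity does the rest.

The diagram chases are calculations with subobjects, tested on generalized elements. An intersection
square of monomorphisms is a pushout once its two maps cover (`isPushout_of_covered`), and pushouts
along monomorphisms cover stably by the van Kampen property (`covered_of_isPushout`). A final
pullback complement with monic d is the largest part D of X whose intersection with B lies in A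
(`IsFPC.fac`, `isFPC_of_fac`). Output squares are pushouts, whereas the input squares of p₂ and p₃
are only final pullback complements. Hence the two lemmas `exists_context` differ: the left one
yields a pushout complement, the right one a final pullback complement.

A match is a subobject of I₂ with a monomorphism to O₁, which gives finiteness. Strictness of ∅
leaves only the empty match with the empty rule, which gives the unit laws. -/

set_option linter.unusedSectionVars false

namespace SqPO

variable {C : Type u} [Category.{v} C]

/-! ### Generalized elements -/

/-- The generalized element `z` belongs to (factors through) `a`. -/
def Fac {Z A X : C} (z : Z ⟶ X) (a : A ⟶ X) : Prop := ∃ t, t ≫ a = z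

/-- A family of morphisms into `Z` is covering if factorizations through monomorphisms can be
checked on the members of the family. -/
def Covered {Z : C} (R : ∀ ⦃V : C⦄, (V ⟶ Z) → Prop) : Prop :=
  ∀ ⦃Y W : C⦄ (s : Y ⟶ W) [Mono s] (q : Z ⟶ W),
    (∀ ⦃V : C⦄ (f : V ⟶ Z), R f → Fac (f ≫ q) s) → Fac q s

theorem Covered.mono {Z : C} {R S : ∀ ⦃V : C⦄, (V ⟶ Z) → Prop} (h : Covered R)
    (hRS : ∀ ⦃V : C⦄ (f : V ⟶ Z), R f → S f) : Covered S :=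
  fun _ _ s _ q H => h s q fun _ f hf => H f (hRS f hf)

theorem Covered.bind {Z : C} {R S : ∀ ⦃V : C⦄, (V ⟶ Z) → Prop} (h : Covered R)
    (hRS : ∀ ⦃V : C⦄ (f : V ⟶ Z), R f → Covered fun _ g => S (g ≫ f)) : Covered S := by
  intro _ _ s _ q H
  refine h s q fun _ f hf => hRS f hf s _ fun _ g hg => ?_
  rw [← Category.assoc]
  exact H _ hg

theorem Covered.of_self {Z : C} {R : ∀ ⦃V : C⦄, (V ⟶ Z) → Prop} (h : R (𝟙 Z)) : Covered R :=
  fun _ _ s _ q H => by simpa using H _ h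

theorem isPullback_of_fac {A B D X : C} {a : A ⟶ B} {b : A ⟶ D} {c : B ⟶ X} {d : D ⟶ X}
    [Mono a] [Mono d] (w : a ≫ c = b ≫ d)
    (h : ∀ ⦃Z : C⦄ (x : Z ⟶ B) (y : Z ⟶ D), x ≫ c = y ≫ d → Fac x a) : IsPullback a b c d := by
  refine ⟨⟨w⟩, ⟨PullbackCone.IsLimit.mk _ (fun s => (h s.fst s.snd s.condition).choose)
    (fun s => (h s.fst s.snd s.condition).choose_spec) (fun s => ?_) fun s t ht _ => ?_⟩⟩
  · rw [← cancel_mono d, Category.assoc, ← w, ← Category.assoc,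
      (h s.fst s.snd s.condition).choose_spec, s.condition]
  · rw [← cancel_mono a, ht, (h s.fst s.snd s.condition).choose_spec]

theorem fac_left {A B D X : C} {a : A ⟶ B} {b : A ⟶ D} {c : B ⟶ X} {d : D ⟶ X}
    (h : IsPullback a b c d) {Z : C} {x : Z ⟶ B} (hx : Fac (x ≫ c) d) : Fac x a := by
  obtain ⟨t, ht⟩ := hx
  exact ⟨h.lift x t ht.symm, h.lift_fst _ _ _⟩

theorem fac_right {A B D X : C} {a : A ⟶ B} {b : A ⟶ D} {c : B ⟶ X} {d : D ⟶ X}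
    (h : IsPullback a b c d) {Z : C} {y : Z ⟶ D} (hy : Fac (y ≫ d) c) : Fac y b :=
  fac_left h.flip hy

/-- A pullback square stays a pullback square after composition with a monomorphism. -/
theorem isPullback_comp_mono {A B D X Y : C} {a : A ⟶ B} {b : A ⟶ D} {c : B ⟶ X} {d : D ⟶ X}
    (h : IsPullback a b c d) (u : X ⟶ Y) [Mono u] : IsPullback a b (c ≫ u) (d ≫ u) :=
  ⟨⟨by rw [reassoc_of% h.w]⟩, ⟨PullbackCone.IsLimit.mk _
    (fun s => h.lift s.fst s.snd (by simpa [← cancel_mono u] using s.condition))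
    (fun s => h.lift_fst _ _ _) (fun s => h.lift_snd _ _ _)
    fun s t h₁ h₂ => h.hom_ext (by simp [h₁]) (by simp [h₂])⟩⟩

/-! ### Final pullback complements by generalized elements -/

/-- The pullback of z along c is the universal piece of z lying in B; if it lies in A, finality
applies to it. -/
theorem IsFPC.fac [HasPullbacks C] {A B D X : C} {a : A ⟶ B} {c : B ⟶ X} {b : A ⟶ D} {d : D ⟶ X}
    (h : IsFPC a c b d) {Z : C} (z : Z ⟶ X)
    (H : ∀ ⦃V : C⦄ (f : V ⟶ Z) (x : V ⟶ B), x ≫ c = f ≫ z → Fac x a) : Fac z d := by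
  have hp := IsPullback.of_hasPullback c z
  obtain ⟨w, hw⟩ := H _ _ hp.w
  obtain ⟨t, ⟨ht, -⟩, -⟩ := h.existsUnique_lift _ _ _ w hp hw
  exact ⟨t, ht⟩

theorem isFPC_of_fac {A B D X : C} {a : A ⟶ B} {c : B ⟶ X} {b : A ⟶ D} {d : D ⟶ X}
    [Mono d] (hp : IsPullback a b c d)
    (H : ∀ ⦃Z : C⦄ (z : Z ⟶ X),
      (∀ ⦃V : C⦄ (f : V ⟶ Z) (x : V ⟶ B), x ≫ c = f ≫ z → Fac x a) → Fac z d) :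
    IsFPC a c b d := by
  refine ⟨hp, fun {P Z} x y z w h hw => ?_⟩
  obtain ⟨t, ht⟩ := H z fun V f x' hx' =>
    ⟨h.lift x' f hx' ≫ w, by rw [Category.assoc, hw, h.lift_fst]⟩
  refine ⟨t, ⟨ht, ?_⟩, fun r hr => ?_⟩
  · rw [← cancel_mono d, Category.assoc, ht, Category.assoc, ← hp.w, reassoc_of% hw, h.w]
  · rw [← cancel_mono d, ht, hr.1]

/-- A pullback complement in a subobject maps to the final pullback complement. -/
theorem IsFPC.exists_hom_of_mono {A B D X D' X' : C} {a : A ⟶ B} {b : A ⟶ D} {c : B ⟶ X}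
    {d : D ⟶ X} {c' : B ⟶ X'} {b' : A ⟶ D'} {d' : D' ⟶ X'} (H' : IsFPC a c' b' d')
    (H : IsPullback a b c d) (u : X ⟶ X') [Mono u] (hc : c ≫ u = c') :
    ∃ w : D ⟶ D', w ≫ d' = d ≫ u ∧ b ≫ w = b' := by
  subst hc
  obtain ⟨w, ⟨h₁, h₂⟩, -⟩ := H'.existsUnique_lift a b (d ≫ u) (𝟙 _) (isPullback_comp_mono H u)
    (Category.id_comp _)
  exact ⟨w, h₁, by simpa using h₂⟩

/-- Final pullback complements are stable under pullback along monomorphisms. -/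
theorem IsFPC.isPullback_of_mono [HasPullbacks C] {A B D X D' X' : C} {a : A ⟶ B} {b : A ⟶ D}
    {c : B ⟶ X} {d : D ⟶ X} {c' : B ⟶ X'} {b' : A ⟶ D'} {d' : D' ⟶ X'} (H : IsFPC a c b d)
    [Mono d] [Mono d'] (H' : IsPullback a b' c' d') (u : X ⟶ X') [Mono u] (hc : c ≫ u = c')
    {w : D ⟶ D'} (hw : w ≫ d' = d ≫ u) : IsPullback d w u d' := by
  -- A piece of X that lies in D' meets B inside A, because A = B ∩ D'; finality of D puts it in D.
  refine isPullback_of_fac hw.symm fun Z x y hxy => H.fac x fun V f x' hx' => ?_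
  refine fac_left H' ⟨f ≫ y, ?_⟩
  rw [Category.assoc, ← hxy, ← reassoc_of% hx', hc]

theorem IsFPC.restrict [HasPullbacks C] {A B X D' X' : C} {a : A ⟶ B} {c : B ⟶ X}
    {c' : B ⟶ X'} {b' : A ⟶ D'} {d' : D' ⟶ X'} (H : IsFPC a c' b' d') [Mono d']
    (u : X ⟶ X') [Mono u] (hc : c ≫ u = c') {D : C} {d : D ⟶ X} {w : D ⟶ D'}
    (hw : IsPullback d w u d') : ∃ b : A ⟶ D, b ≫ w = b' ∧ IsFPC a c b d := by
  have : Mono d := hw.mono_fst_of_mono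
  have e : (a ≫ c) ≫ u = b' ≫ d' := by rw [Category.assoc, hc, H.isPullback.w]
  refine ⟨hw.lift (a ≫ c) b' e, hw.lift_snd _ _ _, isFPC_of_fac ?_ ?_⟩
  · refine (IsPullback.of_right ?_ (hw.lift_fst _ _ e) hw.flip).flip
    rw [hc, hw.lift_snd]
    exact H.isPullback.flip
  · intro Z z hz
    refine fac_left hw (H.fac _ fun V f x hx => hz f x ?_)
    rw [← cancel_mono u, Category.assoc, hc, hx, Category.assoc]

/-- Horizontal composition of final pullback complements. -/
theorem IsFPC.paste [HasPullbacks C] {A B D X D' X' : C} {a : A ⟶ B} {c : B ⟶ X} {b : A ⟶ D}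
    {d : D ⟶ X} {c' : X ⟶ X'} {b' : D ⟶ D'} {d' : D' ⟶ X'} [Mono d'] (H : IsFPC a c b d)
    (H' : IsFPC d c' b' d') : IsFPC a (c ≫ c') (b ≫ b') d' := by
  refine isFPC_of_fac (H.isPullback.flip.paste_horiz H'.isPullback.flip).flip fun Z z hz => ?_
  refine H'.fac z fun V f x hx => H.fac x fun V' f' x' hx' => ?_
  exact hz (f' ≫ f) x' (by rw [reassoc_of% hx', hx, Category.assoc])

/-! ### Pushouts of monomorphisms by generalized elements -/

section

variable [Adhesive C]

/-- Binary unions of subobjects are pushouts over the intersection. -/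
theorem exists_union {A B D X : C} {a : A ⟶ B} {b : A ⟶ D} {c : B ⟶ X} {d : D ⟶ X}
    [Mono c] [Mono d] (h : IsPullback a b c d) :
    ∃ (U : C) (c' : B ⟶ U) (d' : D ⟶ U) (u : U ⟶ X),
      IsPushout a b c' d' ∧ c' ≫ u = c ∧ d' ≫ u = d ∧ Mono u := by
  refine ⟨_, pushout.inl (pullback.fst c d) (pullback.snd c d), pushout.inr _ _,
    pushout.desc c d pullback.condition, ?_, pushout.inl_desc _ _ _, pushout.inr_desc _ _ _,
    inferInstance⟩
  exact (IsPushout.of_hasPushout _ _).of_iso h.isoPullback.symm (Iso.refl _) (Iso.refl _)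
    (Iso.refl _) (by simp) (by simp) (by simp) (by simp)

/-- The union of B and D embeds in X, and covering makes the identity of X factor through this
embedding, which is therefore an isomorphism. -/
theorem isPushout_of_covered {A B D X : C} {a : A ⟶ B} {b : A ⟶ D} {c : B ⟶ X} {d : D ⟶ X}
    [Mono c] [Mono d] (h : IsPullback a b c d)
    (H : Covered fun V (f : V ⟶ X) => Fac f c ∨ Fac f d) : IsPushout a b c d := by
  obtain ⟨U, c', d', u, hp, hc, hd, _⟩ := exists_union h
  obtain ⟨t, ht⟩ := H u (𝟙 X) (by
    rintro V f (⟨t, rfl⟩ | ⟨t, rfl⟩)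
    · exact ⟨t ≫ c', by simp [hc]⟩
    · exact ⟨t ≫ d', by simp [hd]⟩)
  have : IsSplitEpi u := ⟨⟨⟨t, ht⟩⟩⟩
  have : IsIso u := isIso_of_mono_of_isSplitEpi u
  exact hp.of_iso (Iso.refl _) (Iso.refl _) (Iso.refl _) (asIso u) (by simp) (by simp)
    (by simpa using hc) (by simpa using hd)

/-- The union of two subobjects is a subobject. -/
theorem mono_of_isPushout_of_isPullback {A B D X Y : C} {a : A ⟶ B} {b : A ⟶ D} {c : B ⟶ X}
    {d : D ⟶ X} (h : IsPushout a b c d) (u : X ⟶ Y) [Mono (c ≫ u)] [Mono (d ≫ u)]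
    (h' : IsPullback a b (c ≫ u) (d ≫ u)) : Mono u := by
  obtain ⟨U, c', d', u', hp, hc, hd, _⟩ := exists_union h'
  have e : u = (h.isoIsPushout _ _ hp).hom ≫ u' := h.hom_ext (by simp [hc]) (by simp [hd])
  rw [e]
  infer_instance

variable [HasPullbacks C]

/-- By the van Kampen property Z is the pushout of its pulled-back parts, so factorizations on the
parts glue; they agree on the overlap because s is monic. -/
theorem covered_of_isPushout {A B D X : C} {a : A ⟶ B} {b : A ⟶ D} {c : B ⟶ X} {d : D ⟶ X}
    [Mono a] (h : IsPushout a b c d) {Z : C} (z : Z ⟶ X) :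
    Covered fun _ f => Fac (f ≫ z) c ∨ Fac (f ≫ z) d := by
  intro Y W s _ q H
  have hc := (IsPullback.of_hasPullback z c)
  have hd := (IsPullback.of_hasPullback z d)
  obtain ⟨W', f', g', α, -, -, hpo⟩ := (Adhesive.van_kampen h).exists_cube_filling hc hd
  obtain ⟨t₁, h₁⟩ := H (pullback.fst z c) (Or.inl ⟨_, hc.w.symm⟩)
  obtain ⟨t₂, h₂⟩ := H (pullback.fst z d) (Or.inr ⟨_, hd.w.symm⟩)
  refine ⟨hpo.desc t₁ t₂ ?_, hpo.hom_ext (by rw [hpo.inl_desc_assoc, h₁])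
    (by rw [hpo.inr_desc_assoc, h₂])⟩
  rw [← cancel_mono s, Category.assoc, h₁, Category.assoc, h₂, reassoc_of% hpo.w]

/-- Pushout complements are stable under restriction to a subobject. -/
theorem exists_isPushout_restrict {A B D X N : C} {a : A ⟶ B} {b : A ⟶ D} {c : B ⟶ X} {d : D ⟶ X}
    [Mono a] [Mono c] (h : IsPushout a b c d) (u : N ⟶ X) [Mono u] {n : B ⟶ N}
    (hn : n ≫ u = c) : ∃ (D' : C) (b' : A ⟶ D') (d' : D' ⟶ N), IsPushout a b' n d' := by
  have : Mono d := Adhesive.mono_of_isPushout_of_mono_left h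
  have hw := IsPullback.of_hasPullback u d
  obtain ⟨b', -, hb'⟩ := (IsFPC.of_isPushout h).restrict u hn hw
  have : Mono n := mono_of_mono_fac hn
  -- The restricted complement is N ∩ D.
  refine ⟨_, b', pullback.fst u d, isPushout_of_covered hb'.isPullback ?_⟩
  refine (covered_of_isPushout h u).mono ?_
  rintro V f (⟨t, ht⟩ | hf)
  · exact Or.inl ⟨t, by rw [← cancel_mono u, Category.assoc, hn, ht]⟩
  · exact Or.inr (fac_left hw hf)

end

/-! ### Triple compositions -/

/-- The simultaneous composition of three rules: `p₁` is applied (backwards, from `X₁`), `p₂`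
rewrites `X₁` to `X₂` with context `L`, and `p₃` is applied to `X₂`. The covering conditions say
that the diagram contains nothing but the images of the three rules. -/
structure Triple (p₃ p₂ p₁ : Rule C) where
  (X₂ X₁ L J G : C)
  i₃ : p₃.I ⟶ X₂
  o₂ : p₂.O ⟶ X₂
  l₂ : L ⟶ X₂
  l₁ : L ⟶ X₁
  i₂ : p₂.I ⟶ X₁
  o₁ : p₁.O ⟶ X₁
  k₂ : p₂.K ⟶ L
  k₁ : p₁.K ⟶ J
  j : J ⟶ X₁
  k₃ : p₃.K ⟶ G
  g : G ⟶ X₂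
  mono_i₃ : Mono i₃
  mono_i₂ : Mono i₂
  mono_o₁ : Mono o₁
  poO : IsPushout p₂.o k₂ o₂ l₂
  fpcI : IsFPC p₂.i i₂ k₂ l₁
  poc : IsPushout p₁.o k₁ o₁ j
  fpc : IsFPC p₃.i i₃ k₃ g
  covL : ∀ ⦃Z : C⦄ (z : Z ⟶ L),
    Covered fun _ f => Fac (f ≫ z) k₂ ∨ Fac (f ≫ z ≫ l₂) i₃ ∨ Fac (f ≫ z ≫ l₁) o₁
  covX₁ : ∀ ⦃Z : C⦄ (z : Z ⟶ X₁),
    Covered fun _ f => Fac (f ≫ z) i₂ ∨ Fac (f ≫ z) o₁ ∨ Fac (f ≫ z) l₁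

/-- An isomorphism of triple compositions. -/
structure TripleIso {p₃ p₂ p₁ : Rule C} (T T' : Triple p₃ p₂ p₁) where
  e₂ : T.X₂ ≅ T'.X₂
  e₁ : T.X₁ ≅ T'.X₁
  eL : T.L ≅ T'.L
  i₃_e₂ : T.i₃ ≫ e₂.hom = T'.i₃
  o₂_e₂ : T.o₂ ≫ e₂.hom = T'.o₂
  l₂_e₂ : T.l₂ ≫ e₂.hom = eL.hom ≫ T'.l₂
  l₁_e₁ : T.l₁ ≫ e₁.hom = eL.hom ≫ T'.l₁
  i₂_e₁ : T.i₂ ≫ e₁.hom = T'.i₂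
  o₁_e₁ : T.o₁ ≫ e₁.hom = T'.o₁

section

variable [Adhesive C] [HasMonoFPCs C]

theorem compClass_mk {p₂ p₁ : Rule C} {m : Match p₂ p₁} (D : CompDiagram m) :
    compClass ⟦m⟧ = ⟦D.comp⟧ :=
  Quotient.sound (CompDiagram.nonempty_ruleIso _ _ (RuleIso.refl _) (RuleIso.refl _) (Iso.refl _)
    (by simp [RuleIso.refl]) (by simp [RuleIso.refl]))

namespace Triple

variable {p₃ p₂ p₁ : Rule C} (T : Triple p₃ p₂ p₁)

instance : Mono T.i₃ := T.mono_i₃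
instance : Mono T.i₂ := T.mono_i₂
instance : Mono T.o₁ := T.mono_o₁
instance : Mono T.l₂ := Adhesive.mono_of_isPushout_of_mono_left T.poO
instance : Mono T.l₁ := (HasMonoFPCs.mono_of_isFPC T.fpcI).2
instance : Mono T.k₂ := (HasMonoFPCs.mono_of_isFPC T.fpcI).1
instance : Mono T.o₂ := Adhesive.mono_of_isPushout_of_mono_right T.poO
instance : Mono T.j := Adhesive.mono_of_isPushout_of_mono_left T.poc
instance : Mono T.g := (HasMonoFPCs.mono_of_isFPC T.fpc).2

theorem fpcO : IsFPC p₂.o T.o₂ T.k₂ T.l₂ := IsFPC.of_isPushout T.poO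

theorem fpc₁ : IsFPC p₁.o T.o₁ T.k₁ T.j := IsFPC.of_isPushout T.poc

variable [HasPullbacks C]

/-- The composite of the three rules. -/
noncomputable def comp : Rule C where
  O := pushout p₃.o T.k₃
  K := pullback (pullback.snd T.g T.l₂ ≫ T.l₁) T.j
  I := pushout p₁.i T.k₁
  o := (pullback.fst _ _ ≫ pullback.fst _ _) ≫ pushout.inr p₃.o T.k₃
  i := pullback.snd _ _ ≫ pushout.inr p₁.i T.k₁
  mono_o := by
    have : Mono (pushout.inr p₃.o T.k₃) :=
      Adhesive.mono_of_isPushout_of_mono_left (IsPushout.of_hasPushout _ _)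
    infer_instance
  mono_i := by
    have : Mono (pushout.inr p₁.i T.k₁) :=
      Adhesive.mono_of_isPushout_of_mono_left (IsPushout.of_hasPushout _ _)
    infer_instance

end Triple

/-- The composition diagram of `p₂` with `p₁` embeds into a triple composition. -/
structure LeftEmb {p₃ p₂ p₁ : Rule C} {m : Match p₂ p₁} (D : CompDiagram m)
    (T : Triple p₃ p₂ p₁) where
  u : D.N ⟶ T.X₁
  w : D.K₂' ⟶ T.L
  v : D.O₂₁ ⟶ T.X₂
  mono_u : Mono u
  n₂_u : D.n₂ ≫ u = T.i₂
  n₁_u : D.n₁ ≫ u = T.o₁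
  i₂'_u : D.i₂' ≫ u = w ≫ T.l₁
  o₂'_v : D.o₂' ≫ v = w ≫ T.l₂
  n₂s_v : D.n₂s ≫ v = T.o₂

/-- The composition diagram of `p₃` with `p₂` embeds into a triple composition. -/
structure RightEmb {p₃ p₂ p₁ : Rule C} {m : Match p₃ p₂} (E : CompDiagram m)
    (T : Triple p₃ p₂ p₁) where
  v : E.N ⟶ T.X₂
  w : E.K₁' ⟶ T.L
  u : E.I₂₁ ⟶ T.X₁
  mono_v : Mono v
  n₂_v : E.n₂ ≫ v = T.i₃
  n₁_v : E.n₁ ≫ v = T.o₂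
  o₁'_v : E.o₁' ≫ v = w ≫ T.l₂
  i₁'_u : E.i₁' ≫ u = w ≫ T.l₁
  n₁s_u : E.n₁s ≫ u = T.i₂

theorem isPullback_of_mono_span {M M' A B X : C} {f : M ⟶ A} {g : M ⟶ B} {f' : M' ⟶ A}
    {g' : M' ⟶ B} {a : A ⟶ X} {b : B ⟶ X} (h : IsPullback f g a b) (e : M' ≅ M)
    (hf : e.hom ≫ f = f') (hg : e.hom ≫ g = g') : IsPullback f' g' a b :=
  h.of_iso e.symm (Iso.refl _) (Iso.refl _) (Iso.refl _) (by simp [← hf]) (by simp [← hg])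
    (by simp) (by simp)

variable [HasPullbacks C]

/-! ### Triples seen from p₃ ∘ (p₂ ∘ p₁) -/

namespace LeftEmb

variable {p₃ p₂ p₁ : Rule C} {m : Match p₂ p₁} {D : CompDiagram m} {T : Triple p₃ p₂ p₁}
  (e : LeftEmb D T)

instance : Mono e.u := e.mono_u

theorem isPullback_w : IsPullback D.i₂' e.w e.u T.l₁ :=
  D.fpc.isPullback_of_mono T.fpcI.isPullback e.u e.n₂_u e.i₂'_u.symm

instance : Mono e.w := e.isPullback_w.mono_snd_of_mono

theorem k₂_w : D.k₂ ≫ e.w = T.k₂ := by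
  rw [← cancel_mono T.l₁, Category.assoc, ← e.i₂'_u, ← reassoc_of% D.fpc.isPullback.w, e.n₂_u,
    T.fpcI.isPullback.w]

theorem isPushout_w : IsPushout D.o₂' e.w e.v T.l₂ := by
  refine IsPushout.of_top ?_ e.o₂'_v D.poO
  rw [e.k₂_w, e.n₂s_v]
  exact T.poO

instance : Mono e.v := Adhesive.mono_of_isPushout_of_mono_right e.isPushout_w

theorem isPullback_match (e : LeftEmb D T) : IsPullback m.m₂ m.m₁ T.i₂ T.o₁ := by
  have h := isPullback_comp_mono (Adhesive.isPullback_of_isPushout_of_mono_left D.po) e.u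
  rwa [e.n₂_u, e.n₁_u] at h

/-- X₂ is covered by O₂ and L, and L by K₂, I₃ and O₁. The part of L in O₁ lies in L ∩ N = K₂', so
everything outside I₃ comes from O₂₁. -/
theorem covered_v {Z : C} (z : Z ⟶ T.X₂) :
    Covered fun _ f => Fac (f ≫ z) T.i₃ ∨ Fac (f ≫ z) e.v := by
  refine (covered_of_isPushout T.poO z).bind fun V f hf => ?_
  obtain ⟨t, ht⟩ | ⟨t, ht⟩ := hf
  · refine Covered.of_self (Or.inr ⟨t ≫ D.n₂s, ?_⟩)
    simp [e.n₂s_v, ht]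
  · refine (T.covL t).mono ?_
    rintro W g (⟨s, hs⟩ | hs | hs)
    · refine Or.inr ⟨s ≫ D.k₂ ≫ D.o₂', ?_⟩
      simp only [Category.assoc, e.o₂'_v, reassoc_of% e.k₂_w, reassoc_of% hs, ht]
    · exact Or.inl (by simpa [ht] using hs)
    · obtain ⟨s, hs⟩ := hs
      obtain ⟨r, hr⟩ : Fac (g ≫ t) e.w := fac_right e.isPullback_w
        ⟨s ≫ D.n₁, by simp [e.n₁_u, hs]⟩
      refine Or.inr ⟨r ≫ D.o₂', ?_⟩
      simp only [Category.assoc, e.o₂'_v, reassoc_of% hr, ht]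

theorem isPushout_of_isPullback {M : C} {m₃ : M ⟶ p₃.I} {m₂ : M ⟶ D.O₂₁}
    (h : IsPullback m₃ m₂ T.i₃ e.v) : IsPushout m₃ m₂ T.i₃ e.v :=
  isPushout_of_covered h (by simpa using e.covered_v (𝟙 _))

theorem isPushout_u : IsPushout D.i₂' e.w e.u T.l₁ := by
  refine isPushout_of_covered e.isPullback_w ((T.covX₁ (𝟙 _)).mono ?_)
  rintro V f (⟨t, ht⟩ | ⟨t, ht⟩ | h)
  · exact Or.inl ⟨t ≫ D.n₂, by simpa [e.n₂_u] using ht⟩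
  · exact Or.inl ⟨t ≫ D.n₁, by simpa [e.n₁_u] using ht⟩
  · exact Or.inr (by simpa using h)

theorem exists_y : ∃ y : D.K₁' ⟶ T.J, D.k₁ ≫ y = T.k₁ ∧ IsPullback D.o₁' y e.u T.j := by
  obtain ⟨y, hy, hy'⟩ := T.fpc₁.exists_hom_of_mono (IsFPC.of_isPushout D.poc).isPullback e.u e.n₁_u
  exact ⟨y, hy', (IsFPC.of_isPushout D.poc).isPullback_of_mono T.fpc₁.isPullback e.u e.n₁_u hy⟩

/-- The squares that extend the composite rule to the context of a triple composition. -/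
theorem exists_context {K : C} {x : K ⟶ T.L} {y : K ⟶ T.J} (h : IsPullback x y T.l₁ T.j) :
    ∃ k : D.K₂₁ ⟶ K, IsPushout D.comp.o k e.v (x ≫ T.l₂) ∧
      ∃ t : D.K₁' ⟶ T.J, D.k₁ ≫ t = T.k₁ ∧ IsPushout D.o₁'' k t y := by
  obtain ⟨t, ht, hp⟩ := e.exists_y
  have : Mono t := hp.mono_snd_of_mono
  have : Mono x := h.mono_fst_of_mono
  have : Mono y := h.mono_snd_of_mono
  have hk : (D.i₂'' ≫ e.w) ≫ T.l₁ = (D.o₁'' ≫ t) ≫ T.j := by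
    rw [Category.assoc, ← e.i₂'_u, reassoc_of% D.pb.w, hp.w, Category.assoc]
  -- With K = L ∩ J inside X₁, the context L is the union of K₂' and K, with intersection K₂₁.
  -- Pasting with `isPushout_w` then makes K the pushout complement needed for the second match.
  have hL : IsPushout D.i₂'' (h.lift _ _ hk) e.w x := by
    refine isPushout_of_covered ?_ ?_
    · refine isPullback_of_fac (h.lift_fst _ _ hk).symm fun Z a b hab => ?_
      refine fac_left D.pb (fac_left hp ⟨b ≫ y, ?_⟩)
      rw [Category.assoc, Category.assoc, e.i₂'_u, reassoc_of% hab, h.w]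
    · refine (covered_of_isPushout T.poc T.l₁).mono ?_
      rintro V f (⟨s, hs⟩ | hf)
      · exact Or.inl (fac_right e.isPullback_w ⟨s ≫ D.n₁, by simp [e.n₁_u, hs]⟩)
      · exact Or.inr (fac_left h hf)
  refine ⟨h.lift _ _ hk, hL.paste_horiz e.isPushout_w, t, ht, ?_⟩
  · refine isPushout_of_covered ?_ ?_
    · refine isPullback_of_fac (h.lift_snd _ _ hk).symm fun Z a b hab => ?_
      refine fac_right D.pb (fac_left e.isPullback_w ⟨b ≫ x, ?_⟩)
      rw [Category.assoc, Category.assoc, hp.w, reassoc_of% hab, h.w]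
    · refine (T.covX₁ T.j).mono ?_
      rintro V f (⟨s, hs⟩ | ⟨s, hs⟩ | hf)
      · exact Or.inl (fac_right hp ⟨s ≫ D.n₂, by simp [e.n₂_u, hs]⟩)
      · exact Or.inl (fac_right hp ⟨s ≫ D.n₁, by simp [e.n₁_u, hs]⟩)
      · exact Or.inr (fac_right h hf)

theorem exists_match : ∃ n : Match p₃ D.comp, IsPullback n.m₂ n.m₁ T.i₃ e.v := by
  have hp := IsPullback.of_hasPullback T.i₃ e.v
  have : Mono (pullback.fst T.i₃ e.v) := inferInstance
  have : Mono (pullback.snd T.i₃ e.v) := inferInstance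
  obtain ⟨k, hk, -⟩ := e.exists_context (IsPullback.of_hasPullback T.l₁ T.j)
  exact ⟨{
    M := pullback T.i₃ e.v
    m₂ := pullback.fst _ _
    m₁ := pullback.snd _ _
    mono_m₂ := ‹_›
    mono_m₁ := ‹_›
    admissible := ⟨_, _, _, _, _, _, e.isPushout_of_isPullback hp, hk⟩ }, hp⟩

theorem compClass_eq {n : Match p₃ D.comp} (hn : IsPullback n.m₂ n.m₁ T.i₃ e.v) :
    compClass ⟦n⟧ = ⟦T.comp⟧ := by
  have h := IsPullback.of_hasPullback T.l₁ T.j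
  obtain ⟨k, hk, t, ht, hkt⟩ := e.exists_context h
  obtain ⟨r, hr, hr'⟩ := D.poI.exists_desc (pushout.inl p₁.i T.k₁) (t ≫ pushout.inr p₁.i T.k₁)
    (by rw [pushout.condition, reassoc_of% ht])
  have hI : IsPushout D.i₁' t r (pushout.inr p₁.i T.k₁) := by
    refine IsPushout.of_top ?_ hr' D.poI
    rw [ht, hr]
    exact IsPushout.of_hasPushout _ _
  have hc : (pullback.fst (pullback.snd T.g T.l₂ ≫ T.l₁) T.j ≫ pullback.snd T.g T.l₂) ≫ T.l₁ =
      pullback.snd (pullback.snd T.g T.l₂ ≫ T.l₁) T.j ≫ T.j := by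
    rw [Category.assoc, pullback.condition]
  have hK : IsPullback (pullback.fst (pullback.snd T.g T.l₂ ≫ T.l₁) T.j ≫ pullback.fst T.g T.l₂)
      (h.lift _ _ hc) T.g (pullback.fst T.l₁ T.j ≫ T.l₂) := by
    refine IsPullback.paste_horiz (IsPullback.of_right ?_ (h.lift_fst _ _ hc) h.flip).flip
      (IsPullback.of_hasPullback T.g T.l₂)
    rw [h.lift_snd]
    exact (IsPullback.of_hasPullback _ _).flip
  -- This diagram is assembled from the data of T, so its composite is `T.comp` up to identities.
  let F : CompDiagram n := ⟨_, _, _, _, _, _, _, _, _, _, _, _, _, _, _, _, _, _,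
    e.isPushout_of_isPullback hn, hk, hkt.paste_horiz hI, T.fpc,
    IsPushout.of_hasPushout p₃.o T.k₃, hK⟩
  refine (compClass_mk F).trans (Quotient.sound ⟨Iso.refl _, Iso.refl _, Iso.refl _, ?_, ?_⟩)
  · simp [F, CompDiagram.comp, Triple.comp]
  · simp [F, CompDiagram.comp, Triple.comp]

end LeftEmb

namespace LeftEmb

variable {p₃ p₂ p₁ : Rule C} {m : Match p₂ p₁} {D : CompDiagram m} {T T' : Triple p₃ p₂ p₁}

theorem match_equiv (e : LeftEmb D T) (e' : LeftEmb D T') (i : TripleIso T T')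
    {n n' : Match p₃ D.comp} (hn : IsPullback n.m₂ n.m₁ T.i₃ e.v)
    (hn' : IsPullback n'.m₂ n'.m₁ T'.i₃ e'.v) : n ≈ n' := by
  have hu : e.u ≫ i.e₁.hom = e'.u := D.po.hom_ext
    (by rw [reassoc_of% e.n₂_u, i.i₂_e₁, e'.n₂_u]) (by rw [reassoc_of% e.n₁_u, i.o₁_e₁, e'.n₁_u])
  have hw : e.w ≫ i.eL.hom = e'.w := by
    rw [← cancel_mono T'.l₁, Category.assoc, ← i.l₁_e₁, ← reassoc_of% e.i₂'_u, hu, e'.i₂'_u]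
  have hv : e.v ≫ i.e₂.hom = e'.v := D.poO.hom_ext
    (by rw [reassoc_of% e.n₂s_v, i.o₂_e₂, e'.n₂s_v])
    (by rw [reassoc_of% e.o₂'_v, i.l₂_e₂, reassoc_of% hw, e'.o₂'_v])
  obtain ⟨k, h₂, h₁⟩ := isPullback_iso hn hn' (Iso.refl _) (Iso.refl D.O₂₁) i.e₂
    (by simp [i.i₃_e₂]) (hv.trans (Category.id_comp _).symm)
  exact ⟨k, by simpa using h₂.symm, h₁.symm.trans (Category.comp_id _)⟩

/-- The triple is recovered in stages: X₂ is the pushout of the second match, L is the essentially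
unique complement of O₂ in X₂, and X₁ is N and L glued along K₂'. -/
theorem nonempty_tripleIso (e : LeftEmb D T) (e' : LeftEmb D T') {n n' : Match p₃ D.comp}
    (hn : IsPullback n.m₂ n.m₁ T.i₃ e.v) (hn' : IsPullback n'.m₂ n'.m₁ T'.i₃ e'.v)
    (h : n ≈ n') : Nonempty (TripleIso T T') := by
  obtain ⟨k, h₂, h₁⟩ := h
  obtain ⟨e₂, hi₃, hv⟩ := isPushout_iso (e.isPushout_of_isPullback hn)
    (e'.isPushout_of_isPullback hn') k (Iso.refl _) (Iso.refl _) (by simp [h₂])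
    ((Category.comp_id _).trans h₁.symm)
  simp only [Iso.refl_hom, Category.id_comp] at hi₃ hv
  have ho₂ : T.o₂ ≫ e₂.hom = T'.o₂ := by rw [← e.n₂s_v, ← e'.n₂s_v, Category.assoc, hv]
  obtain ⟨eL, hk₂, hl₂⟩ := T.fpcO.iso T'.fpcO (Iso.refl _) (Iso.refl _) e₂ (by simp)
    (by simp [ho₂])
  have hw : e.w ≫ eL.hom = e'.w := by
    rw [← cancel_mono T'.l₂, Category.assoc, ← hl₂, ← reassoc_of% e.o₂'_v, hv, e'.o₂'_v]
  obtain ⟨e₁, hu, hl₁⟩ := isPushout_iso e.isPushout_u e'.isPushout_u (Iso.refl _) (Iso.refl _) eL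
    (by simp) (by simp [hw])
  simp only [Iso.refl_hom, Category.id_comp] at hu
  exact ⟨⟨e₂, e₁, eL, hi₃, ho₂, hl₂, hl₁, by rw [← e.n₂_u, Category.assoc, hu, e'.n₂_u],
    by rw [← e.n₁_u, Category.assoc, hu, e'.n₁_u]⟩⟩

end LeftEmb

/-! ### From triples to left pairs and back -/

namespace Triple

variable {p₃ p₂ p₁ : Rule C} (T : Triple p₃ p₂ p₁)

theorem exists_leftMatch : ∃ m : Match p₂ p₁, IsPullback m.m₂ m.m₁ T.i₂ T.o₁ := by
  have h := IsPullback.of_hasPullback T.i₂ T.o₁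
  obtain ⟨N, n₂, n₁, u, hN, -, hu, _⟩ := exists_union h
  obtain ⟨K, k, l, hK⟩ := exists_isPushout_restrict T.poc u hu
  exact ⟨⟨_, pullback.fst _ _, pullback.snd _ _, _, n₂, n₁, K, k, l, hN, hK⟩, h⟩

theorem nonempty_leftEmb {m : Match p₂ p₁} (h : IsPullback m.m₂ m.m₁ T.i₂ T.o₁)
    (D : CompDiagram m) : Nonempty (LeftEmb D T) := by
  obtain ⟨u, hu₂, hu₁⟩ := D.po.exists_desc T.i₂ T.o₁ h.w
  have : Mono (D.n₂ ≫ u) := by rw [hu₂]; infer_instance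
  have : Mono (D.n₁ ≫ u) := by rw [hu₁]; infer_instance
  have : Mono u := mono_of_isPushout_of_isPullback D.po u (by rwa [hu₂, hu₁])
  obtain ⟨w, hw, hw'⟩ := T.fpcI.exists_hom_of_mono D.fpc.isPullback u hu₂
  obtain ⟨v, hv, hv'⟩ := D.poO.exists_desc T.o₂ (w ≫ T.l₂) (by rw [T.poO.w, reassoc_of% hw'])
  exact ⟨⟨u, w, v, ‹_›, hu₂, hu₁, hw.symm, hv', hv⟩⟩

end Triple

/-- The complement K of K₂₁ in X₂ is all that is missing: gluing it to K₂' and K₁' along K₂₁ gives L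
and J, and gluing L to N along K₂' gives X₁. -/
theorem CompDiagram.exists_triple_left {p₃ p₂ p₁ : Rule C} {m : Match p₂ p₁} (D : CompDiagram m)
    (n : Match p₃ D.comp) : ∃ (T : Triple p₃ p₂ p₁) (e : LeftEmb D T),
      IsPullback n.m₂ n.m₁ T.i₃ e.v := by
  obtain ⟨X₂, i₃, v, K, k, l, hn, hk⟩ : ∃ (X₂ : C) (i₃ : p₃.I ⟶ X₂) (v : D.O₂₁ ⟶ X₂) (K : C)
      (k : D.K₂₁ ⟶ K) (l : K ⟶ X₂),
      IsPushout n.m₂ n.m₁ i₃ v ∧ IsPushout (D.i₂'' ≫ D.o₂') k v l := n.admissible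
  have : Mono i₃ := Adhesive.mono_of_isPushout_of_mono_right hn
  have : Mono v := Adhesive.mono_of_isPushout_of_mono_left hn
  have : Mono k := (Adhesive.isPullback_of_isPushout_of_mono_left hk).mono_snd_of_mono
  obtain ⟨L, w, r, hL⟩ : ∃ (L : C) (w : D.K₂' ⟶ L) (r : K ⟶ L), IsPushout D.i₂'' k w r :=
    ⟨_, _, _, IsPushout.of_hasPushout _ _⟩
  have : Mono w := Adhesive.mono_of_isPushout_of_mono_right hL
  obtain ⟨l₂, hl₂, rfl⟩ := hL.exists_desc (D.o₂' ≫ v) l (by rw [← hk.w, Category.assoc])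
  have hv : IsPushout D.o₂' w v l₂ := IsPushout.of_left hk hl₂.symm hL
  obtain ⟨X₁, u, l₁, hu⟩ : ∃ (X₁ : C) (u : D.N ⟶ X₁) (l₁ : L ⟶ X₁), IsPushout D.i₂' w u l₁ :=
    ⟨_, _, _, IsPushout.of_hasPushout _ _⟩
  have : Mono u := Adhesive.mono_of_isPushout_of_mono_right hu
  have : Mono l₁ := Adhesive.mono_of_isPushout_of_mono_left hu
  have hLu := hL.paste_horiz hu
  -- The pasted pushout has left side K₂₁ ⟶ N, which also factors through K₁'. Splitting it along
  -- that factorization produces the pushout complement of p₁.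
  rw [D.pb.w] at hLu
  obtain ⟨J, t, r', hJ⟩ : ∃ (J : C) (t : D.K₁' ⟶ J) (r' : K ⟶ J), IsPushout D.o₁'' k t r' :=
    ⟨_, _, _, IsPushout.of_hasPushout _ _⟩
  obtain ⟨j, hj, hj'⟩ := hJ.exists_desc (D.o₁' ≫ u) (r ≫ l₁) (by rw [← hLu.w, Category.assoc])
  rw [← hj'] at hLu
  have hju : IsPushout D.o₁' t u j := IsPushout.of_left hLu hj.symm hJ
  obtain ⟨G, k₃, g, hG⟩ := HasMonoFPCs.exists_isFPC p₃.i i₃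
  refine ⟨{
    X₂ := X₂, X₁ := X₁, L := L, J := J, G := G
    i₃ := i₃, o₂ := D.n₂s ≫ v, l₂ := l₂, l₁ := l₁, i₂ := D.n₂ ≫ u, o₁ := D.n₁ ≫ u
    k₂ := D.k₂ ≫ w, k₁ := D.k₁ ≫ t, j := j, k₃ := k₃, g := g
    mono_i₃ := inferInstance, mono_i₂ := inferInstance, mono_o₁ := inferInstance
    poO := D.poO.paste_vert hv
    fpcI := D.fpc.paste (IsFPC.of_isPushout hu)
    poc := D.poc.paste_vert hju
    fpc := hG
    covL := ?_
    covX₁ := ?_ },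
    ⟨u, w, v, ‹_›, rfl, rfl, hu.w, hv.w, rfl⟩, Adhesive.isPullback_of_isPushout_of_mono_left hn⟩
  · intro Z z
    refine (covered_of_isPushout hn (z ≫ l₂)).bind fun V f hf => ?_
    obtain hf | hf := hf
    · exact Covered.of_self (Or.inr (Or.inl (by simpa using hf)))
    · obtain ⟨s, hs⟩ : Fac (f ≫ z) w :=
        fac_right (Adhesive.isPullback_of_isPushout_of_mono_left hv)
          (by rw [Category.assoc]; exact hf)
      refine (covered_of_isPushout D.po (s ≫ D.i₂')).mono ?_
      rintro W h (hh | ⟨q, hq⟩)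
      · obtain ⟨q, hq⟩ : Fac (h ≫ s) D.k₂ := fac_right D.fpc.isPullback (by simpa using hh)
        exact Or.inl ⟨q, by simp [reassoc_of% hq, hs]⟩
      · refine Or.inr (Or.inr ⟨q, ?_⟩)
        rw [reassoc_of% hq, hu.w, reassoc_of% hs, Category.assoc]
  · intro Z z
    refine (covered_of_isPushout hu z).bind fun V f hf => ?_
    obtain ⟨s, hs⟩ | hf := hf
    · refine (covered_of_isPushout D.po s).mono ?_
      rintro W h (⟨q, hq⟩ | ⟨q, hq⟩)
      · exact Or.inl ⟨q, by rw [reassoc_of% hq, hs, Category.assoc]⟩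
      · exact Or.inr (Or.inl ⟨q, by rw [reassoc_of% hq, hs, Category.assoc]⟩)
    · exact Covered.of_self (Or.inr (Or.inr (by simpa using hf)))

/-! ### Triples seen from (p₃ ∘ p₂) ∘ p₁ -/

namespace RightEmb

variable {p₃ p₂ p₁ : Rule C} {m : Match p₃ p₂} {E : CompDiagram m} {T T' : Triple p₃ p₂ p₁}
  (e : RightEmb E T)

instance : Mono e.v := e.mono_v

theorem isPullback_w : IsPullback E.o₁' e.w e.v T.l₂ :=
  (IsFPC.of_isPushout E.poc).isPullback_of_mono T.fpcO.isPullback e.v e.n₁_v e.o₁'_v.symm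

instance : Mono e.w := e.isPullback_w.mono_snd_of_mono

theorem isPullback_match (e : RightEmb E T) : IsPullback m.m₂ m.m₁ T.i₃ T.o₂ := by
  have h := isPullback_comp_mono (Adhesive.isPullback_of_isPushout_of_mono_left E.po) e.v
  rwa [e.n₂_v, e.n₁_v] at h

theorem isPullback_u : IsPullback E.i₁' e.w e.u T.l₁ := by
  refine isPullback_of_fac e.i₁'_u fun Z x y hxy => ?_
  -- I₂₁ is covered by I₂ and K₁', and the part of I₂ inside L lies in K₂, hence in K₁'.
  refine covered_of_isPushout E.poI x E.i₁' x fun V f hf => ?_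
  obtain ⟨t, ht⟩ | hf := hf
  · obtain ⟨s, hs⟩ : Fac t p₂.i := fac_left T.fpcI.isPullback
      ⟨f ≫ y, by rw [Category.assoc, ← hxy, ← reassoc_of% ht, e.n₁s_u]⟩
    exact ⟨s ≫ E.k₁, by rw [Category.assoc, ← E.poI.w, reassoc_of% hs, ht]⟩
  · exact hf

theorem mono_u : Mono e.u := by
  have h₁ : Mono (E.n₁s ≫ e.u) := by rw [e.n₁s_u]; infer_instance
  have h₂ : Mono (E.i₁' ≫ e.u) := by rw [e.i₁'_u]; infer_instance
  refine mono_of_isPushout_of_isPullback E.poI e.u ?_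
  refine isPullback_of_fac (by rw [reassoc_of% E.poI.w]) fun Z x y hxy => ?_
  refine fac_left T.fpcI.isPullback ⟨y ≫ e.w, ?_⟩
  rw [Category.assoc, ← e.i₁'_u, ← hxy, e.n₁s_u]

instance : Mono e.u := e.mono_u

theorem covered_u {Z : C} (z : Z ⟶ T.X₁) :
    Covered fun _ f => Fac (f ≫ z) e.u ∨ Fac (f ≫ z) T.o₁ := by
  refine (T.covX₁ z).bind fun V f hf => ?_
  obtain ⟨t, ht⟩ | hf | ⟨t, ht⟩ := hf
  · exact Covered.of_self (Or.inl ⟨t ≫ E.n₁s, by simp [e.n₁s_u, ht]⟩)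
  · exact Covered.of_self (Or.inr (by simpa using hf))
  · refine (T.covL t).mono ?_
    rintro W g (⟨s, hs⟩ | ⟨s, hs⟩ | hs)
    · refine Or.inl ⟨s ≫ p₂.i ≫ E.n₁s, ?_⟩
      simp only [Category.assoc, e.n₁s_u, T.fpcI.isPullback.w, reassoc_of% hs, ht]
    · obtain ⟨r, hr⟩ : Fac (g ≫ t) e.w := fac_right e.isPullback_w
        ⟨s ≫ E.n₂, by simp [e.n₂_v, hs]⟩
      refine Or.inl ⟨r ≫ E.i₁', ?_⟩
      simp only [Category.assoc, e.i₁'_u, reassoc_of% hr, ht]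
    · exact Or.inr (by simpa [ht] using hs)

theorem isPushout_of_isPullback {M : C} {m₂ : M ⟶ E.I₂₁} {m₁ : M ⟶ p₁.O}
    (h : IsPullback m₂ m₁ e.u T.o₁) : IsPushout m₂ m₁ e.u T.o₁ :=
  isPushout_of_covered h (by simpa using e.covered_u (𝟙 _))

theorem isPushout_v : IsPushout E.o₁' e.w e.v T.l₂ := by
  refine isPushout_of_covered e.isPullback_w ((covered_of_isPushout T.poO (𝟙 _)).mono ?_)
  rintro V f (⟨t, ht⟩ | h)
  · exact Or.inl ⟨t ≫ E.n₁, by simpa [e.n₁_v] using ht⟩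
  · exact Or.inr (by simpa using h)

theorem exists_match : ∃ n : Match E.comp p₁, IsPullback n.m₂ n.m₁ e.u T.o₁ := by
  have hp := IsPullback.of_hasPullback e.u T.o₁
  have : Mono (pullback.fst e.u T.o₁) := inferInstance
  have : Mono (pullback.snd e.u T.o₁) := inferInstance
  exact ⟨{
    M := pullback e.u T.o₁
    m₂ := pullback.fst _ _
    m₁ := pullback.snd _ _
    mono_m₂ := ‹_›
    mono_m₁ := ‹_›
    admissible := ⟨_, _, _, _, _, _, e.isPushout_of_isPullback hp, T.poc⟩ }, hp⟩

theorem exists_y : ∃ y : E.K₂' ⟶ T.G, E.k₂ ≫ y = T.k₃ ∧ IsPullback E.i₂' y e.v T.g := by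
  obtain ⟨y, hy, hy'⟩ := T.fpc.exists_hom_of_mono E.fpc.isPullback e.v e.n₂_v
  exact ⟨y, hy', E.fpc.isPullback_of_mono T.fpc.isPullback e.v e.n₂_v hy⟩

/-- The squares that extend the composite rule to the context of a triple composition. -/
theorem exists_context {K : C} {x : K ⟶ T.G} {y : K ⟶ T.L} (h : IsPullback x y T.g T.l₂) :
    ∃ k : E.K₂₁ ⟶ K, IsFPC E.comp.i e.u k (y ≫ T.l₁) ∧
      ∃ t : E.K₂' ⟶ T.G, E.k₂ ≫ t = T.k₃ ∧ IsPushout E.i₂'' k t x := by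
  obtain ⟨t, ht, hp⟩ := e.exists_y
  have : Mono t := hp.mono_snd_of_mono
  have : Mono x := h.mono_fst_of_mono
  have : Mono y := h.mono_snd_of_mono
  have hk : (E.i₂'' ≫ t) ≫ T.g = (E.o₁'' ≫ e.w) ≫ T.l₂ := by
    rw [Category.assoc, ← hp.w, reassoc_of% E.pb.w, e.o₁'_v, Category.assoc]
  have hfpc : IsFPC (E.o₁'' ≫ E.i₁') e.u (h.lift _ _ hk) (y ≫ T.l₁) := by
    refine isFPC_of_fac (isPullback_of_fac ?_ ?_) ?_
    · rw [h.lift_snd_assoc]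
      simp [e.i₁'_u]
    · intro Z a b hab
      obtain ⟨c, rfl⟩ : Fac a E.i₁' := fac_left e.isPullback_u ⟨b ≫ y, by simpa using hab.symm⟩
      have hc : c ≫ e.w = b ≫ y := by
        rw [← cancel_mono T.l₁, Category.assoc, ← e.i₁'_u]
        simpa using hab
      obtain ⟨d, rfl⟩ : Fac c E.o₁'' := fac_right E.pb (fac_left hp ⟨b ≫ x, by
        rw [Category.assoc, h.w, ← reassoc_of% hc, Category.assoc, e.o₁'_v]⟩)
      exact ⟨d, (Category.assoc _ _ _).symm⟩
    · intro Z z H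
      -- The piece of z in I₂ lies in K₂₁ by hypothesis, so in I₂ ∩ K₁' = K₂; finality of L gives
      -- the factorization.
      obtain ⟨z, rfl⟩ : Fac z T.l₁ := T.fpcI.fac z fun V f a ha => by
        obtain ⟨s, hs⟩ := H f (a ≫ E.n₁s) (by simpa [e.n₁s_u] using ha)
        exact fac_left (Adhesive.isPullback_of_isPushout_of_mono_left E.poI)
          ⟨s ≫ E.o₁'', by rw [Category.assoc, hs]⟩
      -- A piece in I₃ lies in N ∩ L = K₁', so in I₂₁ and by hypothesis in K₂₁. It therefore lies in
      -- I₃ ∩ K₂' = K₃, and finality of G applies.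
      obtain ⟨r, hr⟩ : Fac (z ≫ T.l₂) T.g := T.fpc.fac _ fun V f a ha => by
        rw [← e.n₂_v, ← Category.assoc, ← Category.assoc] at ha
        obtain ⟨c, hc⟩ : Fac (f ≫ z) e.w := fac_right e.isPullback_w ⟨_, ha⟩
        have hc' : c ≫ E.o₁' = a ≫ E.n₂ := by
          rw [← cancel_mono e.v, Category.assoc, e.o₁'_v, reassoc_of% hc, ha, Category.assoc]
        obtain ⟨s, hs⟩ := H f (c ≫ E.i₁') (by
          rw [Category.assoc, e.i₁'_u, reassoc_of% hc])
        have hs' : s ≫ E.o₁'' = c := by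
          rw [← cancel_mono E.i₁', Category.assoc]
          exact hs
        exact fac_left E.fpc.isPullback ⟨s ≫ E.i₂'', by
          rw [Category.assoc, E.pb.w, reassoc_of% hs', hc']⟩
      exact ⟨h.lift r z hr, by rw [h.lift_snd_assoc]⟩
  refine ⟨h.lift _ _ hk, hfpc, t, ht,
    isPushout_of_covered (isPullback_of_fac (h.lift_fst _ _ hk).symm ?_) ?_⟩
  · intro Z a b hab
    refine fac_left E.pb (fac_left e.isPullback_w ⟨b ≫ y, ?_⟩)
    rw [Category.assoc, Category.assoc, hp.w, reassoc_of% hab, h.w]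
  · refine (covered_of_isPushout T.poO T.g).mono ?_
    rintro V f (⟨s, hs⟩ | hf)
    · exact Or.inl (fac_right hp ⟨s ≫ E.n₁, by simp [e.n₁_v, hs]⟩)
    · exact Or.inr (fac_left h hf)

theorem compClass_eq {n : Match E.comp p₁} (hn : IsPullback n.m₂ n.m₁ e.u T.o₁) :
    compClass ⟦n⟧ = ⟦T.comp⟧ := by
  obtain ⟨k, hk, t, ht, hkt⟩ := e.exists_context (IsPullback.of_hasPullback T.g T.l₂)
  obtain ⟨r, hr, hr'⟩ := E.poO.exists_desc (pushout.inl p₃.o T.k₃) (t ≫ pushout.inr p₃.o T.k₃)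
    (by rw [pushout.condition, reassoc_of% ht])
  have hO : IsPushout E.o₂' t r (pushout.inr p₃.o T.k₃) := by
    refine IsPushout.of_top ?_ hr' E.poO
    rw [ht, hr]
    exact IsPushout.of_hasPushout _ _
  let F : CompDiagram n := ⟨_, _, _, _, _, _, _, _, _, _, _, _, _, _, _, _, _, _,
    e.isPushout_of_isPullback hn, T.poc, IsPushout.of_hasPushout p₁.i T.k₁, hk,
    hkt.paste_horiz hO, IsPullback.of_hasPullback _ _⟩
  refine (compClass_mk F).trans (Quotient.sound ⟨Iso.refl _, Iso.refl _, Iso.refl _, ?_, ?_⟩)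
  · simp [F, CompDiagram.comp, Triple.comp]
  · simp [F, CompDiagram.comp, Triple.comp]

theorem match_equiv (e : RightEmb E T) (e' : RightEmb E T') (i : TripleIso T T')
    {n n' : Match E.comp p₁} (hn : IsPullback n.m₂ n.m₁ e.u T.o₁)
    (hn' : IsPullback n'.m₂ n'.m₁ e'.u T'.o₁) : n ≈ n' := by
  have hv : e.v ≫ i.e₂.hom = e'.v := E.po.hom_ext
    (by rw [reassoc_of% e.n₂_v, i.i₃_e₂, e'.n₂_v]) (by rw [reassoc_of% e.n₁_v, i.o₂_e₂, e'.n₁_v])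
  have hw : e.w ≫ i.eL.hom = e'.w := by
    rw [← cancel_mono T'.l₂, Category.assoc, ← i.l₂_e₂, ← reassoc_of% e.o₁'_v, hv, e'.o₁'_v]
  have hu : e.u ≫ i.e₁.hom = e'.u := E.poI.hom_ext
    (by rw [reassoc_of% e.n₁s_u, i.i₂_e₁, e'.n₁s_u])
    (by rw [reassoc_of% e.i₁'_u, i.l₁_e₁, reassoc_of% hw, e'.i₁'_u])
  obtain ⟨k, h₂, h₁⟩ := isPullback_iso hn hn' (Iso.refl E.I₂₁) (Iso.refl _) i.e₁
    (hu.trans (Category.id_comp _).symm) (by simp [i.o₁_e₁])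
  exact ⟨k, h₂.symm.trans (Category.comp_id _), by simpa using h₁.symm⟩

theorem nonempty_tripleIso (e : RightEmb E T) (e' : RightEmb E T') {n n' : Match E.comp p₁}
    (hn : IsPullback n.m₂ n.m₁ e.u T.o₁) (hn' : IsPullback n'.m₂ n'.m₁ e'.u T'.o₁)
    (h : n ≈ n') : Nonempty (TripleIso T T') := by
  obtain ⟨k, h₂, h₁⟩ := h
  obtain ⟨e₁, hu, ho₁⟩ := isPushout_iso (e.isPushout_of_isPullback hn)
    (e'.isPushout_of_isPullback hn') k (Iso.refl _) (Iso.refl _)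
    ((Category.comp_id _).trans h₂.symm) (by simp [h₁])
  simp only [Iso.refl_hom, Category.id_comp] at hu ho₁
  have hi₂ : T.i₂ ≫ e₁.hom = T'.i₂ := by rw [← e.n₁s_u, ← e'.n₁s_u, Category.assoc, hu]
  obtain ⟨eL, hk₂, hl₁⟩ := T.fpcI.iso T'.fpcI (Iso.refl _) (Iso.refl _) e₁ (by simp)
    (by simp [hi₂])
  have hw : e.w ≫ eL.hom = e'.w := by
    rw [← cancel_mono T'.l₁, Category.assoc, ← hl₁, ← reassoc_of% e.i₁'_u, hu, e'.i₁'_u]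
  obtain ⟨e₂, hv, hl₂⟩ := isPushout_iso e.isPushout_v e'.isPushout_v (Iso.refl _) (Iso.refl _) eL
    (by simp) (by simp [hw])
  simp only [Iso.refl_hom, Category.id_comp] at hv
  exact ⟨⟨e₂, e₁, eL, by rw [← e.n₂_v, Category.assoc, hv, e'.n₂_v],
    by rw [← e.n₁_v, Category.assoc, hv, e'.n₁_v], hl₂, hl₁, hi₂, ho₁⟩⟩

end RightEmb

/-! ### From triples to right pairs and back -/

namespace Triple

variable {p₃ p₂ p₁ : Rule C} (T : Triple p₃ p₂ p₁)

theorem exists_rightMatch : ∃ m : Match p₃ p₂, IsPullback m.m₂ m.m₁ T.i₃ T.o₂ := by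
  have h := IsPullback.of_hasPullback T.i₃ T.o₂
  obtain ⟨N, n₂, n₁, u, hN, -, hu, _⟩ := exists_union h
  obtain ⟨K, k, l, hK⟩ := exists_isPushout_restrict T.poO u hu
  exact ⟨⟨_, pullback.fst _ _, pullback.snd _ _, _, n₂, n₁, K, k, l, hN, hK⟩, h⟩

theorem nonempty_rightEmb {m : Match p₃ p₂} (h : IsPullback m.m₂ m.m₁ T.i₃ T.o₂)
    (E : CompDiagram m) : Nonempty (RightEmb E T) := by
  obtain ⟨v, hv₂, hv₁⟩ := E.po.exists_desc T.i₃ T.o₂ h.w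
  have : Mono (E.n₂ ≫ v) := by rw [hv₂]; infer_instance
  have : Mono (E.n₁ ≫ v) := by rw [hv₁]; infer_instance
  have : Mono v := mono_of_isPushout_of_isPullback E.po v (by rwa [hv₂, hv₁])
  obtain ⟨w, hw, hw'⟩ := T.fpcO.exists_hom_of_mono (IsFPC.of_isPushout E.poc).isPullback v hv₁
  obtain ⟨u, hu, hu'⟩ := E.poI.exists_desc T.i₂ (w ≫ T.l₁)
    (by rw [T.fpcI.isPullback.w, reassoc_of% hw'])
  exact ⟨⟨v, w, u, ‹_›, hv₂, hv₁, hw.symm, hu', hu⟩⟩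

end Triple

/-- The second match provides X₁. Applying p₂ to it, by a final pullback complement L and then a
pushout, provides X₂. -/
theorem CompDiagram.exists_triple_right {p₃ p₂ p₁ : Rule C} {m : Match p₃ p₂} (E : CompDiagram m)
    (n : Match E.comp p₁) : ∃ (T : Triple p₃ p₂ p₁) (e : RightEmb E T),
      IsPullback n.m₂ n.m₁ e.u T.o₁ := by
  obtain ⟨X₁, u, o₁, J, k₁, j, hn, hJ⟩ : ∃ (X₁ : C) (u : E.I₂₁ ⟶ X₁) (o₁ : p₁.O ⟶ X₁) (J : C)
      (k₁ : p₁.K ⟶ J) (j : J ⟶ X₁),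
      IsPushout n.m₂ n.m₁ u o₁ ∧ IsPushout p₁.o k₁ o₁ j := n.admissible
  have : Mono u := Adhesive.mono_of_isPushout_of_mono_right hn
  have : Mono o₁ := Adhesive.mono_of_isPushout_of_mono_left hn
  have : Mono E.n₁s := by
    have : Mono E.k₁ := (IsFPC.of_isPushout E.poc).isPullback.mono_snd_of_mono
    exact Adhesive.mono_of_isPushout_of_mono_right E.poI
  have hI := Adhesive.isPullback_of_isPushout_of_mono_left E.poI
  obtain ⟨L, k₂, l₁, hL⟩ := HasMonoFPCs.exists_isFPC p₂.i (E.n₁s ≫ u)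
  obtain ⟨_, _⟩ := HasMonoFPCs.mono_of_isFPC hL
  obtain ⟨w, hw, hw'⟩ := hL.exists_hom_of_mono hI u rfl
  have : Mono (w ≫ l₁) := by rw [hw]; infer_instance
  have : Mono w := mono_of_mono w l₁
  obtain ⟨X₂, o₂, l₂, hX⟩ : ∃ (X₂ : C) (o₂ : p₂.O ⟶ X₂) (l₂ : L ⟶ X₂),
    IsPushout p₂.o k₂ o₂ l₂ := ⟨_, _, _, IsPushout.of_hasPushout _ _⟩
  have : Mono l₂ := Adhesive.mono_of_isPushout_of_mono_left hX
  have : Mono o₂ := Adhesive.mono_of_isPushout_of_mono_right hX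
  obtain ⟨v, hv, hv'⟩ := E.poc.exists_desc o₂ (w ≫ l₂) (by rw [hX.w, reassoc_of% hw'])
  have : Mono (E.n₁ ≫ v) := by rwa [hv]
  have : Mono (E.o₁' ≫ v) := by rw [hv']; infer_instance
  -- N is the pushout of O₂ and K₁' over K₂, and these still intersect in K₂ inside X₂, so N embeds
  -- as their union.
  have : Mono v := by
    refine mono_of_isPushout_of_isPullback E.poc v ?_
    refine isPullback_of_fac (by rw [reassoc_of% E.poc.w]) fun Z x y hxy => ?_
    refine fac_left (Adhesive.isPullback_of_isPushout_of_mono_left hX) ⟨y ≫ w, ?_⟩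
    rw [Category.assoc, ← hv', ← hxy, hv]
  have hcov : ∀ {Z : C} (z : Z ⟶ X₁), Covered fun _ f => Fac (f ≫ z) u ∨ Fac (f ≫ z) o₁ :=
    fun z => covered_of_isPushout hn z
  obtain ⟨G, k₃, g, hG⟩ := HasMonoFPCs.exists_isFPC p₃.i (E.n₂ ≫ v)
  refine ⟨{
    X₂ := X₂, X₁ := X₁, L := L, J := J, G := G
    i₃ := E.n₂ ≫ v, o₂ := o₂, l₂ := l₂, l₁ := l₁, i₂ := E.n₁s ≫ u, o₁ := o₁
    k₂ := k₂, k₁ := k₁, j := j, k₃ := k₃, g := g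
    mono_i₃ := inferInstance, mono_i₂ := inferInstance, mono_o₁ := inferInstance
    poO := hX
    fpcI := hL
    poc := hJ
    fpc := hG
    covL := ?_
    covX₁ := ?_ },
    ⟨v, w, u, ‹_›, rfl, hv, hv', hw.symm, rfl⟩, Adhesive.isPullback_of_isPushout_of_mono_left hn⟩
  · intro Z z
    refine (hcov (z ≫ l₁)).bind fun V f hf => ?_
    obtain ⟨s, hs⟩ | hf := hf
    · refine (covered_of_isPushout E.poI s).bind fun V' f' hf' => ?_
      obtain ⟨q, hq⟩ | ⟨c, hc⟩ := hf'
      · obtain ⟨r, hr⟩ : Fac (f' ≫ f ≫ z) k₂ := fac_right hL.isPullback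
          ⟨q, by rw [reassoc_of% hq]; simp [hs]⟩
        exact Covered.of_self (Or.inl ⟨r, by simp [hr]⟩)
      · have hcw : c ≫ w = f' ≫ f ≫ z := by
          rw [← cancel_mono l₁, Category.assoc, hw, reassoc_of% hc]
          simp [hs]
        refine (covered_of_isPushout E.po (c ≫ E.o₁')).mono ?_
        rintro W h (⟨q, hq⟩ | hq)
        · refine Or.inr (Or.inl ⟨q, ?_⟩)
          rw [reassoc_of% hq, hv', reassoc_of% hcw]
          simp
        · obtain ⟨r, hr⟩ : Fac (h ≫ c) E.k₁ :=
            fac_right (IsFPC.of_isPushout E.poc).isPullback (by simpa using hq)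
          refine Or.inl ⟨r, ?_⟩
          rw [← hw', reassoc_of% hr, hcw]
          simp
    · exact Covered.of_self (Or.inr (Or.inr (by simpa using hf)))
  · intro Z z
    refine (hcov z).bind fun V f hf => ?_
    obtain ⟨s, hs⟩ | hf := hf
    · refine (covered_of_isPushout E.poI s).mono ?_
      rintro W h (⟨q, hq⟩ | ⟨q, hq⟩)
      · exact Or.inl ⟨q, by rw [reassoc_of% hq, hs, Category.assoc]⟩
      · refine Or.inr (Or.inr ⟨q ≫ w, ?_⟩)
        rw [Category.assoc, hw, reassoc_of% hq, hs, Category.assoc]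
    · exact Covered.of_self (Or.inr (Or.inl (by simpa using hf)))

end

/-! ### Finiteness of the set of matches -/

theorem finite_matchClass (hfin : ∀ X : C, Finite (Subobject X))
    (hmono : ∀ Y X : C, Finite {f : Y ⟶ X // Mono f}) (p₂ p₁ : Rule C) :
    Finite (MatchClass p₂ p₁) := by
  have := hfin p₂.I
  have := fun S : Subobject p₂.I => hmono (S : C) p₁.O
  -- Pairs of a subobject and a monomorphism out of it, restricted to those realized by an
  -- admissible match, so that a match can be chosen for each.
  let A := {x : Σ S : Subobject p₂.I, {f : (S : C) ⟶ p₁.O // Mono f} //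
    ∃ (n : Match p₂ p₁) (e : n.M ≅ (x.1 : C)), e.hom ≫ x.1.arrow = n.m₂ ∧ e.hom ≫ x.2.1 = n.m₁}
  refine Finite.of_surjective (fun x : A => (⟦x.2.choose⟧ : MatchClass p₂ p₁)) ?_
  rintro ⟨m⟩
  let i := Subobject.underlyingIso m.m₂
  let x : A := ⟨⟨Subobject.mk m.m₂, i.hom ≫ m.m₁, inferInstance⟩, m, i.symm, by simp [i],
    by simp⟩
  refine ⟨x, Quotient.sound ?_⟩
  obtain ⟨e, h₂, h₁⟩ := x.2.choose_spec
  exact ⟨e ≪≫ i, by simp [← h₂, x, i], by simp [← h₁, x]⟩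

section

variable [Adhesive C] [HasMonoFPCs C]

/-- A diagram that computes the composite along a match class. -/
noncomputable def MatchClass.diagram {p₂ p₁ : Rule C} (m : MatchClass p₂ p₁) :
    CompDiagram m.out := m.out.nonempty_compDiagram.some

theorem compClass_eq_diagram {p₂ p₁ : Rule C} (m : MatchClass p₂ p₁) :
    compClass m = ⟦(MatchClass.diagram m).comp⟧ := by
  conv_lhs => rw [← Quotient.out_eq m]
  exact compClass_mk _

/-! ### Associativity -/

section

variable [HasPullbacks C] {p₃ p₂ p₁ : Rule C}

/-- A composable pair of matches for `p₃ ∘ (p₂ ∘ p₁)`. -/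
abbrev LeftPair (p₃ p₂ p₁ : Rule C) :=
  Σ m : MatchClass p₂ p₁, MatchClass p₃ (MatchClass.diagram m).comp

/-- A composable pair of matches for `(p₃ ∘ p₂) ∘ p₁`. -/
abbrev RightPair (p₃ p₂ p₁ : Rule C) :=
  Σ m : MatchClass p₃ p₂, MatchClass (MatchClass.diagram m).comp p₁

/-- The triple composition `T` belongs to the pair of matches `x`. -/
def LeftPair.Rel (x : LeftPair p₃ p₂ p₁) (T : Triple p₃ p₂ p₁) : Prop :=
  ∃ e : LeftEmb (MatchClass.diagram x.1) T, IsPullback x.2.out.m₂ x.2.out.m₁ T.i₃ e.v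

/-- The triple composition `T` belongs to the pair of matches `y`. -/
def RightPair.Rel (y : RightPair p₃ p₂ p₁) (T : Triple p₃ p₂ p₁) : Prop :=
  ∃ e : RightEmb (MatchClass.diagram y.1) T, IsPullback y.2.out.m₂ y.2.out.m₁ e.u T.o₁

theorem isPullback_out {p q : Rule C} {m : Match q p} {X : C} {a : q.I ⟶ X} {b : p.O ⟶ X}
    (h : IsPullback m.m₂ m.m₁ a b) : IsPullback (⟦m⟧ : MatchClass q p).out.m₂
      (⟦m⟧ : MatchClass q p).out.m₁ a b := by
  obtain ⟨e, h₂, h₁⟩ := Quotient.mk_out (s := matchSetoid q p) m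
  exact isPullback_of_mono_span h e h₂ h₁

theorem match_eq_of_isPullback {p q : Rule C} {m m' : MatchClass q p} {X X' : C} {a : q.I ⟶ X}
    {b : p.O ⟶ X} {a' : q.I ⟶ X'} {b' : p.O ⟶ X'} (h : IsPullback m.out.m₂ m.out.m₁ a b)
    (h' : IsPullback m'.out.m₂ m'.out.m₁ a' b') (i : X ≅ X') (ha : a ≫ i.hom = a')
    (hb : b ≫ i.hom = b') : m = m' := by
  obtain ⟨k, h₂, h₁⟩ := isPullback_iso h h' (Iso.refl _) (Iso.refl _) i (by simp [ha])
    (by simp [hb])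
  exact Quotient.out_equiv_out.1 ⟨k, by simpa using h₂.symm, by simpa using h₁.symm⟩

namespace LeftPair

theorem exists_triple (x : LeftPair p₃ p₂ p₁) : ∃ T, x.Rel T :=
  (MatchClass.diagram x.1).exists_triple_left x.2.out

theorem exists_pair (T : Triple p₃ p₂ p₁) : ∃ x : LeftPair p₃ p₂ p₁, x.Rel T := by
  obtain ⟨m, hm⟩ := T.exists_leftMatch
  obtain ⟨e⟩ := T.nonempty_leftEmb (isPullback_out hm) (MatchClass.diagram ⟦m⟧)
  obtain ⟨n, hn⟩ := e.exists_match
  exact ⟨⟨⟦m⟧, ⟦n⟧⟩, e, isPullback_out hn⟩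

theorem nonempty_tripleIso {x : LeftPair p₃ p₂ p₁} {T T' : Triple p₃ p₂ p₁} (h : x.Rel T)
    (h' : x.Rel T') : Nonempty (TripleIso T T') := by
  obtain ⟨e, h⟩ := h
  obtain ⟨e', h'⟩ := h'
  exact e.nonempty_tripleIso e' h h' (Setoid.refl _)

theorem eq_of_iso {x x' : LeftPair p₃ p₂ p₁} {T T' : Triple p₃ p₂ p₁} (h : x.Rel T)
    (h' : x'.Rel T') (i : TripleIso T T') : x = x' := by
  obtain ⟨m, n⟩ := x
  obtain ⟨m', n'⟩ := x'
  obtain ⟨e, h⟩ := h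
  obtain ⟨e', h'⟩ := h'
  obtain rfl : m = m' :=
    match_eq_of_isPullback e.isPullback_match e'.isPullback_match i.e₁ i.i₂_e₁ i.o₁_e₁
  obtain rfl : n = n' := Quotient.out_equiv_out.1 (e.match_equiv e' i h h')
  rfl

theorem compClass_eq {x : LeftPair p₃ p₂ p₁} {T : Triple p₃ p₂ p₁} (h : x.Rel T) :
    compClass x.2 = ⟦T.comp⟧ := by
  obtain ⟨e, h⟩ := h
  rw [← e.compClass_eq h, Quotient.out_eq]

end LeftPair

namespace RightPair

theorem exists_triple (y : RightPair p₃ p₂ p₁) : ∃ T, y.Rel T :=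
  (MatchClass.diagram y.1).exists_triple_right y.2.out

theorem exists_pair (T : Triple p₃ p₂ p₁) : ∃ y : RightPair p₃ p₂ p₁, y.Rel T := by
  obtain ⟨m, hm⟩ := T.exists_rightMatch
  obtain ⟨e⟩ := T.nonempty_rightEmb (isPullback_out hm) (MatchClass.diagram ⟦m⟧)
  obtain ⟨n, hn⟩ := e.exists_match
  exact ⟨⟨⟦m⟧, ⟦n⟧⟩, e, isPullback_out hn⟩

theorem nonempty_tripleIso {y : RightPair p₃ p₂ p₁} {T T' : Triple p₃ p₂ p₁} (h : y.Rel T)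
    (h' : y.Rel T') : Nonempty (TripleIso T T') := by
  obtain ⟨e, h⟩ := h
  obtain ⟨e', h'⟩ := h'
  exact e.nonempty_tripleIso e' h h' (Setoid.refl _)

theorem eq_of_iso {y y' : RightPair p₃ p₂ p₁} {T T' : Triple p₃ p₂ p₁} (h : y.Rel T)
    (h' : y'.Rel T') (i : TripleIso T T') : y = y' := by
  obtain ⟨m, n⟩ := y
  obtain ⟨m', n'⟩ := y'
  obtain ⟨e, h⟩ := h
  obtain ⟨e', h'⟩ := h'
  obtain rfl : m = m' :=
    match_eq_of_isPullback e.isPullback_match e'.isPullback_match i.e₂ i.i₃_e₂ i.o₂_e₂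
  obtain rfl : n = n' := Quotient.out_equiv_out.1 (e.match_equiv e' i h h')
  rfl

theorem compClass_eq {y : RightPair p₃ p₂ p₁} {T : Triple p₃ p₂ p₁} (h : y.Rel T) :
    compClass y.2 = ⟦T.comp⟧ := by
  obtain ⟨e, h⟩ := h
  rw [← e.compClass_eq h, Quotient.out_eq]

end RightPair

/-- Each kind of pair corresponds bijectively to triples up to isomorphism, so passing through a
chosen triple is a bijection preserving composites. -/
theorem exists_bijective_pairs (p₃ p₂ p₁ : Rule C) :
    ∃ f : LeftPair p₃ p₂ p₁ → RightPair p₃ p₂ p₁, Function.Bijective f ∧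
      ∀ x, compClass (f x).2 = compClass x.2 := by
  choose T hT using LeftPair.exists_triple (p₃ := p₃) (p₂ := p₂) (p₁ := p₁)
  choose f hf using fun x => RightPair.exists_pair (T x)
  refine ⟨f, ⟨fun x x' h => ?_, fun y => ?_⟩, fun x => ?_⟩
  · obtain ⟨i⟩ := RightPair.nonempty_tripleIso (hf x) (h ▸ hf x')
    exact LeftPair.eq_of_iso (hT x) (hT x') i
  · obtain ⟨T', hT'⟩ := y.exists_triple
    obtain ⟨x, hx⟩ := LeftPair.exists_pair T'
    obtain ⟨i⟩ := LeftPair.nonempty_tripleIso (hT x) hx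
    exact ⟨x, RightPair.eq_of_iso (hf x) hT' i⟩
  · rw [RightPair.compClass_eq (hf x), LeftPair.compClass_eq (hT x)]

end

/-! ### Associativity by trilinear extension -/

theorem mul_single_single (a b : Lin C) (x y : ℝ) :
    mul C (Finsupp.single a x) (Finsupp.single b y) = (x * y) • basisMul a b := by
  simp [mul, mul_smul]

theorem basisMul_mk (p₂ p₁ : Rule C)
    [Fintype (MatchClass p₂ p₁)] :
    basisMul (⟦p₂⟧ : Lin C) ⟦p₁⟧ = ∑ m : MatchClass p₂ p₁, δ (compClass m) :=
  finsum_eq_sum_of_fintype _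

theorem mul_basisMul_assoc [HasPullbacks C]
    (hM : ∀ p₂ p₁ : Rule C, Finite (MatchClass p₂ p₁)) (a₃ a₂ a₁ : Lin C) :
    mul C (basisMul a₃ a₂) (δ a₁) = mul C (δ a₃) (basisMul a₂ a₁) := by
  obtain ⟨p₃, rfl⟩ := Quotient.exists_rep a₃
  obtain ⟨p₂, rfl⟩ := Quotient.exists_rep a₂
  obtain ⟨p₁, rfl⟩ := Quotient.exists_rep a₁
  have := fun p₂ p₁ : Rule C => Fintype.ofFinite (MatchClass p₂ p₁)
  obtain ⟨f, hf, hc⟩ := exists_bijective_pairs p₃ p₂ p₁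
  have hL : mul C (δ ⟦p₃⟧) (basisMul ⟦p₂⟧ ⟦p₁⟧) =
      ∑ x : LeftPair p₃ p₂ p₁, δ (compClass x.2) := by
    rw [basisMul_mk, map_sum, Fintype.sum_sigma]
    refine Finset.sum_congr rfl fun m _ => ?_
    rw [compClass_eq_diagram m, δ, δ, mul_single_single, basisMul_mk, mul_one, one_smul]
  have hR : mul C (basisMul ⟦p₃⟧ ⟦p₂⟧) (δ ⟦p₁⟧) =
      ∑ y : RightPair p₃ p₂ p₁, δ (compClass y.2) := by
    rw [basisMul_mk, map_sum, LinearMap.sum_apply, Fintype.sum_sigma]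
    refine Finset.sum_congr rfl fun m _ => ?_
    rw [compClass_eq_diagram m, δ, δ, mul_single_single, basisMul_mk, mul_one, one_smul]
  rw [hL, hR]
  exact (Fintype.sum_bijective f hf _ _ fun x => by rw [hc]).symm

theorem mul_assoc' [HasPullbacks C] (hM : ∀ p₂ p₁ : Rule C, Finite (MatchClass p₂ p₁))
    (R₃ R₂ R₁ : RuleAlgebra C) : mul C (mul C R₃ R₂) R₁ = mul C R₃ (mul C R₂ R₁) := by
  induction R₃ using Finsupp.induction_linear with
  | zero => simp
  | add f g hf hg => simp only [map_add, LinearMap.add_apply, hf, hg]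
  | single a x =>
  induction R₂ using Finsupp.induction_linear with
  | zero => simp
  | add f g hf hg => simp only [map_add, LinearMap.add_apply, hf, hg]
  | single b y =>
  induction R₁ using Finsupp.induction_linear with
  | zero => simp
  | add f g hf hg => simp only [map_add, hf, hg]
  | single c z =>
  have h := mul_basisMul_assoc hM a b c
  -- The outer coefficients are split off so that the outer factors become basis vectors.
  rw [mul_single_single, mul_single_single, ← mul_one z, ← mul_one x, ← smul_eq_mul z,
    ← smul_eq_mul x, ← Finsupp.smul_single, ← Finsupp.smul_single]
  simp only [map_smul, LinearMap.smul_apply]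
  change _ • _ • mul C (basisMul a b) (δ c) = _ • _ • mul C (δ a) (basisMul b c)
  rw [h]
  simp only [smul_smul, smul_eq_mul]
  congr 1
  ring

/-! ### The unit -/

section

variable [HasInitial C] [HasStrictInitialObjects C]

theorem basisMul_eq_single {q p r : Rule C} (m : Match q p)
    (hm : ∀ m' : Match q p, m' ≈ m) (D : CompDiagram m) (h : Nonempty (RuleIso D.comp r)) :
    basisMul (⟦q⟧ : Lin C) ⟦p⟧ = δ ⟦r⟧ := by
  let : Unique (MatchClass q p) := ⟨⟨⟦m⟧⟩, by rintro ⟨m'⟩; exact Quotient.sound (hm m')⟩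
  refine (finsum_unique _).trans (congrArg δ ?_)
  exact (compClass_mk D).trans (Quotient.sound h)

theorem emptyRule_basisMul (p : Rule C) : basisMul (⟦emptyRule C⟧ : Lin C) ⟦p⟧ = δ ⟦p⟧ := by
  let m : Match (emptyRule C) p :=
    { M := ⊥_ C
      m₂ := 𝟙 (⊥_ C)
      m₁ := initial.to p.O
      mono_m₂ := inferInstanceAs (Mono (𝟙 (⊥_ C)))
      mono_m₁ := inferInstance
      admissible := ⟨p.O, initial.to p.O, 𝟙 _, p.K, 𝟙 _, p.o, IsPushout.of_id_fst,
        IsPushout.of_id_snd⟩ }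
  refine basisMul_eq_single m (fun m' => ?_) ⟨p.O, p.O, p.K, p.O, p.I, p.K, initial.to p.O, 𝟙 _,
    initial.to p.O, 𝟙 _, initial.to p.O, 𝟙 _, 𝟙 _, p.o, 𝟙 _, p.i, p.o, 𝟙 _, IsPushout.of_id_fst,
    IsPushout.of_id_snd, IsPushout.of_id_snd,
    IsFPC.of_isPushout (a := 𝟙 (⊥_ C)) (c := initial.to p.O) IsPushout.of_id_fst,
    IsPushout.of_id_fst, IsPullback.of_id_snd⟩
    ⟨Iso.refl _, Iso.refl _, Iso.refl _, ?_, ?_⟩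
  · have : IsIso (Y := ⊥_ C) m'.m₂ := initialIsInitial.isIso_to _
    let e : m'.M ≅ ⊥_ C := asIso (Y := ⊥_ C) m'.m₂
    exact ⟨e, Category.comp_id (Y := ⊥_ C) m'.m₂, (initialIsInitial.ofIso e.symm).hom_ext _ _⟩
  · simp [CompDiagram.comp]
  · simp [CompDiagram.comp]

theorem basisMul_emptyRule (p : Rule C) : basisMul (⟦p⟧ : Lin C) ⟦emptyRule C⟧ = δ ⟦p⟧ := by
  let m : Match p (emptyRule C) :=
    { M := ⊥_ C
      m₂ := initial.to p.I
      m₁ := 𝟙 (⊥_ C)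
      mono_m₂ := inferInstance
      mono_m₁ := inferInstanceAs (Mono (𝟙 (⊥_ C)))
      admissible := ⟨p.I, 𝟙 _, initial.to p.I, p.I, initial.to p.I, 𝟙 _, IsPushout.of_id_snd,
        IsPushout.of_id_fst⟩ }
  refine basisMul_eq_single m (fun m' => ?_) ⟨p.I, p.K, p.I, p.O, p.I, p.K, 𝟙 _, initial.to p.I,
    𝟙 _, p.i, 𝟙 _, p.o, initial.to p.I, 𝟙 _, initial.to p.I, 𝟙 _, 𝟙 _, p.i, IsPushout.of_id_snd,
    IsPushout.of_id_fst, IsPushout.of_id_fst, IsFPC.of_isPushout IsPushout.of_id_snd,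
    IsPushout.of_id_snd, IsPullback.of_id_fst⟩
    ⟨Iso.refl _, Iso.refl _, Iso.refl _, ?_, ?_⟩
  · have : IsIso (Y := ⊥_ C) m'.m₁ := initialIsInitial.isIso_to _
    let e : m'.M ≅ ⊥_ C := asIso (Y := ⊥_ C) m'.m₁
    exact ⟨e, (initialIsInitial.ofIso e.symm).hom_ext _ _, Category.comp_id (Y := ⊥_ C) m'.m₁⟩
  · simp [CompDiagram.comp]
  · simp [CompDiagram.comp]

theorem emptyRule_mul (R : RuleAlgebra C) : mul C (δ ⟦emptyRule C⟧) R = R := by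
  induction R using Finsupp.induction_linear with
  | zero => simp
  | add f g hf hg => simp only [map_add, hf, hg]
  | single a x =>
    obtain ⟨p, rfl⟩ := Quotient.exists_rep a
    rw [δ, mul_single_single, emptyRule_basisMul, δ]
    simp

theorem mul_emptyRule (R : RuleAlgebra C) : mul C R (δ ⟦emptyRule C⟧) = R := by
  induction R using Finsupp.induction_linear with
  | zero => simp
  | add f g hf hg => simp only [map_add, LinearMap.add_apply, hf, hg]
  | single a x =>
    obtain ⟨p, rfl⟩ := Quotient.exists_rep a
    rw [δ, mul_single_single, basisMul_emptyRule, δ]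
    simp

end

end

end SqPO

theorem mainTheorem3 {C : Type u} [Category.{v} C] [HasPullbacks C] [Adhesive C]
    [SqPO.HasMonoFPCs C] [HasInitial C] [HasStrictInitialObjects C]
    (hfin : ∀ X : C, Finite (Subobject X))
    (hmono : ∀ Y X : C, Finite {f : Y ⟶ X // Mono f}) :
    (∀ p₂ p₁ : SqPO.Rule C, Finite (SqPO.MatchClass p₂ p₁)) ∧
    (∀ R₃ R₂ R₁ : SqPO.RuleAlgebra C,
      SqPO.mul C (SqPO.mul C R₃ R₂) R₁ = SqPO.mul C R₃ (SqPO.mul C R₂ R₁)) ∧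
    (∀ R : SqPO.RuleAlgebra C, SqPO.mul C (SqPO.δ ⟦SqPO.emptyRule C⟧) R = R) ∧
    (∀ R : SqPO.RuleAlgebra C, SqPO.mul C R (SqPO.δ ⟦SqPO.emptyRule C⟧) = R) :=
  have hM := SqPO.finite_matchClass hfin hmono
  ⟨hM, SqPO.mul_assoc' hM, SqPO.emptyRule_mul, SqPO.mul_emptyRule⟩
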